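/- Let $n\ge 0$. A frame is a tuple $\mathfrak F=(W,R_1,\dots,R_n)$ with $W\neq\emptyset$ and $R_i\subseteq W\times W$. $\mathcal{ML}^n_{\mathcal{ALCO}_u}$-concepts are given by $$C::=A\mid\{a\}\mid\neg C\mid C\sqcap C\mid\exists r.C\mid\exists u.C\mid\Diamond_iC\qquad(1\le i\le n),$$ where $A$, $r$, $a$ range over countably infinite, pairwise disjoint sets of concept, role and individual names, and $u$ is the universal role. A model with expanding domains based on $\mathfrak F$ assigns to every $w\in W$ a non-empty domain $\Delta^w$, with $\Delta^w\subseteq\Delta^{v}$ whenever $wR_iv$ for some $i$, and an interpretation $\mathcal I_w$ of names over $\Delta^w$: $A^{\mathcal I_w}\subseteq\Delta^w$, $r^{\mathcal I_w}\subseteq\Delta^w\times\Delta^w$, $u^{\mathcal I_w}=\Delta^w\times\Delta^w$, and $a^{\mathcal I_w}\in\Delta^w$, which in a partial model may also be undefined and in a total model is always defined. The model has constant domains if all $\Delta^w$ are equal. Concepts are interpreted as usual; in particular $\{a\}^{\mathcal I_w}$ is $\{a^{\mathcal I_w}\}$ if $a^{\mathcal I_w}$ is defined and $\emptyset$ otherwise,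 $(\neg C)^{\mathcal I_w}=\Delta^w\setminus C^{\mathcal I_w}$, and $(\Diamond_iC)^{\mathcal I_w}=\{d\in\Delta^w\mid d\in C^{\mathcal I_{v}}\text{ for some }v\text{ with }wR_iv\}$. $\mathcal{ML}^n_{lin}$-concepts are given by $$C::=A\mid\neg C\mid C\sqcap C\mid\exists o.C\mid\Diamond_iC\qquad(1\le i\le n),$$ with a single role $o$. Their models, with expanding or constant domains, are as above, except that only concept names and $o$ are interpreted, and $o$ is interpreted rigidly by a Noetherian strict linear order: there is one strict linear order $<$ without infinite ascending chains on the individuals such that $o^{\mathcal I_w}$ is the restriction of $<$ to $\Delta^w$, for every $w\in W$. For a class $\mathcal C$ of frames, a concept $C$ is $\mathcal C$-satisfiable if $C^{\mathcal I_w}\ne\emptyset$ for some world $w$ of some model based on a frame in $\mathcal C$. **Theorem.** For every class $\mathcal C$ of frames, $\mathcal C$-satisfiability of $\mathcal{ML}^n_{\mathcal{ALCO}_u}$-concepts (in total models and likewise in partial models) is many-one reducible in double exponential time to $\mathcal C$-satisfiability of $\mathcal{ML}^n_{lin}$-concepts, both with constant domains and with expanding domains (the same kind of domains on both sides). That is,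 in each case there is a function $f$, computable by a Turing machine in time $2^{2^{p(k)}}$ for some polynomial $p$, where $k$ is the length of the input concept written as a word over a finite alphabet, such that $C$ is $\mathcal C$-satisfiable if and only if $f(C)$ is. -/

import Mathlib

universe u v

namespace ModalDL

/-- A frame for `n` modalities: a non-empty set of worlds with `n` binary accessibility relations. -/
structure Frame (n : ℕ) where
  World : Type u
  nonempty : Nonempty World
  rel : Fin n → World → World → Prop

/-- Names are finite binary words, a countably infinite set. Concept names, role names and
individual names are kept apart by the constructors in which they occur. -/
abbrev Name : Type := List Bool

/-- Concepts of the modal description logic with nominals and the universal role: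
`C ::= A | {a} | ¬C | C ⊓ C | ∃r.C | ∃u.C | ◇ᵢ C`. -/
inductive Concept (n : ℕ) : Type
  | atom (A : Name)
  | nominal (a : Name)
  | neg (C : Concept n)
  | and (C D : Concept n)
  | existsRole (r : Name) (C : Concept n)
  | existsUniv (C : Concept n)
  | dia (i : Fin n) (C : Concept n)

/-- Concepts of the modal description logic with the single role `o`:
`C ::= A | ¬C | C ⊓ C | ∃o.C | ◇ᵢ C`. -/
inductive LinConcept (n : ℕ) : Type
  | atom (A : Name)
  | neg (C : LinConcept n)
  | and (C D : LinConcept n)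
  | existsOrd (C : LinConcept n)
  | dia (i : Fin n) (C : LinConcept n)

/-- Expanding domains over a frame: every world `w` has a non-empty domain `dom w`, and domains
can only grow along the accessibility relations. -/
structure Domains {n : ℕ} (F : Frame.{u} n) where
  Elt : Type v
  dom : F.World → Set Elt
  dom_nonempty : ∀ w, (dom w).Nonempty
  dom_mono : ∀ i w w', F.rel i w w' → dom w ⊆ dom w'

/-- The two semantics of domains. Constant domains are expanding domains that do not vary. -/
inductive DomainKind : Type
  | constant
  | expanding

/-- The domains are of the given kind. -/
def DomainKind.Admits {n : ℕ} {F : Frame.{u} n} : DomainKind → Domains.{u, v} F → Prop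
  | .constant, M => ∀ w w', M.dom w = M.dom w'
  | .expanding, _ => True

/-- An interpretation of concept, role and individual names at every world of a frame.
Individual names are non-rigid, and `indiv w a = none` means that `a` does not denote at `w`. -/
structure Interp {n : ℕ} (F : Frame.{u} n) extends Domains.{u, v} F where
  concept : F.World → Name → Set Elt
  concept_subset : ∀ w A, concept w A ⊆ dom w
  role : F.World → Name → Set (Elt × Elt)
  role_subset : ∀ w r, role w r ⊆ dom w ×ˢ dom w
  indiv : F.World → Name → Option Elt
  indiv_mem : ∀ w a d, indiv w a = some d → d ∈ dom w

/-- In total interpretations every individual name denotes at every world, in partial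
interpretations it may or may not denote. -/
inductive NameKind : Type
  | total
  | partially

/-- The interpretation of the individual names is of the given kind. -/
def NameKind.Admits {n : ℕ} {F : Frame.{u} n} : NameKind → Interp.{u, v} F → Prop
  | .total, M => ∀ w a, ∃ d, M.indiv w a = some d
  | .partially, _ => True

/-- The extension of a concept at a world. -/
def Interp.ext {n : ℕ} {F : Frame.{u} n} (M : Interp.{u, v} F) :
    Concept n → F.World → Set M.Elt
  | .atom A, w => M.concept w A
  | .nominal a, w => {d | M.indiv w a = some d}
  | .neg C, w => M.dom w \ M.ext C w
  | .and C D, w => M.ext C w ∩ M.ext D w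
  | .existsRole r C, w => {d | ∃ e, (d, e) ∈ M.role w r ∧ e ∈ M.ext C w}
  | .existsUniv C, w => {d | d ∈ M.dom w ∧ ∃ e, e ∈ M.dom w ∧ e ∈ M.ext C w}
  | .dia i C, w => {d | d ∈ M.dom w ∧ ∃ w', F.rel i w w' ∧ d ∈ M.ext C w'}

/-- `C` has a non-empty extension at some world of some interpretation, with domains and
individual names of the given kinds, that is based on a frame in the class `𝒞`. -/
def Concept.Satisfiable {n : ℕ} (𝒞 : Set (Frame.{u} n)) (k : DomainKind) (t : NameKind)
    (C : Concept n) : Prop :=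
  ∃ F ∈ 𝒞, ∃ M : Interp.{u, v} F, k.Admits M.toDomains ∧ t.Admits M ∧
    ∃ w, (M.ext C w).Nonempty

/-- An interpretation of concept names at every world of a frame, together with one Noetherian
strict linear order (no infinite ascending chains) on the individuals. The role `o` is
interpreted at every world as the restriction of that order to the domain of the world. -/
structure LinInterp {n : ℕ} (F : Frame.{u} n) extends Domains.{u, v} F where
  concept : F.World → Name → Set Elt
  concept_subset : ∀ w A, concept w A ⊆ dom w
  lt : Elt → Elt → Prop
  lt_strictTotalOrder : IsStrictTotalOrder Elt lt
  lt_noetherian : WellFounded (fun d e => lt e d)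

/-- The extension of a concept at a world. -/
def LinInterp.ext {n : ℕ} {F : Frame.{u} n} (M : LinInterp.{u, v} F) :
    LinConcept n → F.World → Set M.Elt
  | .atom A, w => M.concept w A
  | .neg C, w => M.dom w \ M.ext C w
  | .and C D, w => M.ext C w ∩ M.ext D w
  | .existsOrd C, w => {d | d ∈ M.dom w ∧ ∃ e, e ∈ M.dom w ∧ M.lt d e ∧ e ∈ M.ext C w}
  | .dia i C, w => {d | d ∈ M.dom w ∧ ∃ w', F.rel i w w' ∧ d ∈ M.ext C w'}

/-- `C` has a non-empty extension at some world of some interpretation, with domains of the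
given kind, that is based on a frame in the class `𝒞`. -/
def LinConcept.Satisfiable {n : ℕ} (𝒞 : Set (Frame.{u} n)) (k : DomainKind)
    (C : LinConcept n) : Prop :=
  ∃ F ∈ 𝒞, ∃ M : LinInterp.{u, v} F, k.Admits M.toDomains ∧ ∃ w, (M.ext C w).Nonempty

/-- The finite alphabet in which concepts of both logics are written. -/
inductive Letter (n : ℕ) : Type
  | concept
  | nominal
  | neg
  | and
  | existsRole
  | existsUniv
  | existsOrd
  | dia (i : Fin n)
  | bit (b : Bool)
  | endMark

/-- A name, written as its bits followed by an end marker. -/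
def writeName {n : ℕ} (a : Name) : List (Letter n) := a.map Letter.bit ++ [Letter.endMark]

/-- A concept as a word, in prefix notation. -/
def Concept.write {n : ℕ} : Concept n → List (Letter n)
  | .atom A => .concept :: writeName A
  | .nominal a => .nominal :: writeName a
  | .neg C => .neg :: C.write
  | .and C D => .and :: (C.write ++ D.write)
  | .existsRole r C => .existsRole :: (writeName r ++ C.write)
  | .existsUniv C => .existsUniv :: C.write
  | .dia i C => .dia i :: C.write

/-- A concept as a word, in prefix notation. -/
def LinConcept.write {n : ℕ} : LinConcept n → List (Letter n)
  | .atom A => .concept :: writeName A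
  | .neg C => .neg :: C.write
  | .and C D => .and :: (C.write ++ D.write)
  | .existsOrd C => .existsOrd :: C.write
  | .dia i C => .dia i :: C.write

theorem writeName_append_inj {n : ℕ} (a b : Name) (s t : List (Letter n))
    (h : writeName a ++ s = writeName b ++ t) : a = b ∧ s = t := by
  induction a generalizing b with
  | nil => cases b <;> simp_all [writeName]
  | cons x a ih =>
    cases b with
    | nil => simp [writeName] at h
    | cons y b =>
      simp only [writeName, List.map_cons, List.cons_append, List.cons.injEq,
        Letter.bit.injEq] at h
      obtain ⟨rfl, rfl⟩ := ih b h.2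
      exact ⟨by rw [h.1], rfl⟩

theorem Concept.write_append_inj {n : ℕ} (C D : Concept n) (s t : List (Letter n))
    (h : C.write ++ s = D.write ++ t) : C = D ∧ s = t := by
  induction C generalizing D s t with
  | atom A =>
    cases D <;> simp [Concept.write] at h
    simpa using writeName_append_inj _ _ _ _ h
  | nominal a =>
    cases D <;> simp [Concept.write] at h
    simpa using writeName_append_inj _ _ _ _ h
  | neg C ih =>
    cases D <;> simp [Concept.write] at h
    simpa using ih _ _ _ h
  | and C₁ C₂ ih₁ ih₂ =>
    cases D <;> simp [Concept.write] at h
    obtain ⟨rfl, h2⟩ := ih₁ _ _ _ h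
    simpa using ih₂ _ _ _ h2
  | existsRole r C ih =>
    cases D <;> simp [Concept.write] at h
    obtain ⟨rfl, h2⟩ := writeName_append_inj _ _ _ _ h
    simpa using ih _ _ _ h2
  | existsUniv C ih =>
    cases D <;> simp [Concept.write] at h
    simpa using ih _ _ _ h
  | dia i C ih =>
    cases D <;> simp [Concept.write] at h
    obtain ⟨rfl, h⟩ := h
    simpa using ih _ _ _ h

/-- Different concepts are written as different words. -/
theorem Concept.write_injective {n : ℕ} : Function.Injective (Concept.write (n := n)) :=
  fun C D h => (Concept.write_append_inj C D [] [] (by simpa using h)).1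

theorem LinConcept.write_append_inj {n : ℕ} (C D : LinConcept n) (s t : List (Letter n))
    (h : C.write ++ s = D.write ++ t) : C = D ∧ s = t := by
  induction C generalizing D s t with
  | atom A =>
    cases D <;> simp [LinConcept.write] at h
    simpa using writeName_append_inj _ _ _ _ h
  | neg C ih =>
    cases D <;> simp [LinConcept.write] at h
    simpa using ih _ _ _ h
  | and C₁ C₂ ih₁ ih₂ =>
    cases D <;> simp [LinConcept.write] at h
    obtain ⟨rfl, h2⟩ := ih₁ _ _ _ h
    simpa using ih₂ _ _ _ h2
  | existsOrd C ih =>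
    cases D <;> simp [LinConcept.write] at h
    simpa using ih _ _ _ h
  | dia i C ih =>
    cases D <;> simp [LinConcept.write] at h
    obtain ⟨rfl, h⟩ := h
    simpa using ih _ _ _ h

/-- Different concepts are written as different words. -/
theorem LinConcept.write_injective {n : ℕ} : Function.Injective (LinConcept.write (n := n)) :=
  fun C D h => (LinConcept.write_append_inj C D [] [] (by simpa using h)).1

/-- Some Turing machine (with finitely many stacks over finite alphabets) computes `f` on words,
under the encodings `ea` and `eb`, in time `2 ^ 2 ^ p(k)` for a polynomial `p`, where `k` is the
length of the input word. -/
def ComputableInDoubleExpTime {α β Γ₀ Γ₁ : Type} (ea : α → List Γ₀) (eb : β → List Γ₁)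
    (f : α → β) : Prop :=
  ∃ T : Turing.TM2ComputableInTime ea eb f, (∀ s, Finite (T.tm.Γ s)) ∧
    ∃ p : Polynomial ℕ, ∀ k, T.time k ≤ 2 ^ 2 ^ p.eval k

/-- The decision problem `P` is many-one reducible to `Q` in double exponential time. -/
def ReducibleInDoubleExpTime {α β Γ₀ Γ₁ : Type} (ea : α → List Γ₀) (eb : β → List Γ₁)
    (P : α → Prop) (Q : β → Prop) : Prop :=
  ∃ f : α → β, ComputableInDoubleExpTime ea eb f ∧ ∀ a, P a ↔ Q (f a)

end ModalDL

/-! A point `d₀` that precedes all relevant elements can state, with `∃o` alone, facts about all of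
them: `∃o.X` at `d₀` says that some later element satisfies `X`. This replaces the universal role.
Every subconcept occurrence gets an atom, named by its position in the written word. At `d₀` the
translation requires these atoms to obey the clauses of the semantics, under enough nested boxes to
cover the modal depth of the concept, and asks for a later element with the atom of the whole
concept.

Two constructors are not directly available. A nominal `{a}` becomes "the last element with a
certain atom": this describes at most one element because the order is linear, and it exists as soon
as the atom is satisfied, because the order is Noetherian. Total names get the additional demand
that the atom be satisfied; partial names do not. A concept `∃r.D` becomes an atom of its own. Roles
are not rigid, so at each world separately one may take the largest relation that respects these
atoms: `(e, e')` is an edge unless `e'` has the atom of some `E` while `e` lacks the atom of `∃r.E`.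
An element with the atom of `∃r.D` then needs an element in `D` that avoids every `E` whose `∃r.E`
fails at it. There is one constraint for each set of positions that could be the set of failures
(`witnessConstraint`), hence exponentially many.

From a model of the concept, a model of the translation arises by reversing a well-order of the
elements and putting one new point in front, present at every world (`Interp.toLin`,
`Interp.first_mem_constraints`). Conversely, let `e₀` be the later element with the atom of the
whole concept. The decoded model keeps the elements after `d₀`. For expanding domains, worlds whose
domain lacks `e₀` keep only the dummy element `e₀`; since the remaining worlds are closed under
accessibility, domains still expand (`LinInterp.decode`). The truth lemma `LinInterp.mem_decode_ext`
goes by induction on subconcepts.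

For the complexity, the translation is computed by a structured stack program, which compiles to a
machine with the same time bound up to one step. Prefix notation read from the right is postfix
evaluation, so one scan with a stack of positions writes the constraints for one selection, and a
binary counter runs through the selections. The boxes at most multiply the length by a single
exponential, so the total time is in fact singly exponential (`translateTime_le`). -/

namespace StackProgram

/-! ### Structured stack programs and their compilation to Turing machines -/

open Turing Function

/-- Structured programs over stacks indexed by `K` with letters in `Γ`. -/
inductive Prog (K Γ : Type) : Type
  | nop
  | push (k : K) (a : Γ)
  | seq (p q : Prog K Γ)
  /-- Pop the stack `k` and branch on the result. -/
  | popCase (k : K) (f : Option Γ → Prog K Γ)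
  /-- While the top of the stack `k` satisfies `c`, pop it and run the body on it. -/
  | loop (k : K) (c : Γ → Bool) (f : Γ → Prog K Γ)

namespace Prog

variable {K Γ : Type}

/-- The control points of a program. -/
def Label : Prog K Γ → Type
  | nop => Unit
  | push _ _ => Unit
  | seq p q => p.Label ⊕ q.Label
  | popCase _ f => Option (Σ o, (f o).Label)
  | loop _ _ f => Option (Σ a, (f a).Label)

theorem finite_label [Finite Γ] : ∀ p : Prog K Γ, Finite p.Label
  | nop => inferInstanceAs (Finite Unit)
  | push _ _ => inferInstanceAs (Finite Unit)
  | seq p q =>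
    have := finite_label p
    have := finite_label q
    inferInstanceAs (Finite (p.Label ⊕ q.Label))
  | popCase _ f =>
    have := fun o => finite_label (f o)
    inferInstanceAs (Finite (Option (Σ o, (f o).Label)))
  | loop _ _ f =>
    have := fun a => finite_label (f a)
    inferInstanceAs (Finite (Option (Σ a, (f a).Label)))

/-- The control point at which the execution of a program starts. -/
def entry : (p : Prog K Γ) → p.Label
  | nop => ()
  | push _ _ => ()
  | seq p _ => Sum.inl p.entry
  | popCase _ _ => none
  | loop _ _ _ => none

open TM2.Stmt in
/-- The machine code of a program whose control points are embedded by `ι` into the labels `Λ` and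
that ends by jumping to `e`. The internal state holds the letter that was read last. -/
def code {Λ : Type} : (p : Prog K Γ) → (p.Label → Λ) → Λ → p.Label →
    TM2.Stmt (fun _ : K => Γ) Λ (Option Γ)
  | nop, _, e, _ => goto fun _ => e
  | push k a, _, e, _ => TM2.Stmt.push k (fun _ => a) (goto fun _ => e)
  | seq p q, ι, _, Sum.inl l => code p (fun l => ι (Sum.inl l)) (ι (Sum.inr q.entry)) l
  | seq _ q, ι, e, Sum.inr l => code q (fun l => ι (Sum.inr l)) e l
  | popCase k f, ι, _, none =>
    pop k (fun _ o => o) (goto fun o => ι (some ⟨o, (f o).entry⟩))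
  | popCase _ f, ι, e, some ⟨o, l⟩ => code (f o) (fun l => ι (some ⟨o, l⟩)) e l
  | loop k c f, ι, e, none =>
    peek k (fun _ o => o) (branch (fun o => o.any c)
      (pop k (fun _ o => o) (goto fun o => o.elim e fun a => ι (some ⟨a, (f a).entry⟩)))
      (goto fun _ => e))
  | loop _ _ f, ι, _, some ⟨a, l⟩ => code (f a) (fun l => ι (some ⟨a, l⟩)) (ι none) l

variable [DecidableEq K]

/-- `Runs p s s' t`: the program `p` turns the stacks `s` into `s'` in time at most `t`. -/
inductive Runs : Prog K Γ → (K → List Γ) → (K → List Γ) → ℕ → Prop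
  | nop (s) : Runs nop s s 1
  | push (k a s) : Runs (push k a) s (update s k (a :: s k)) 1
  | seq {p q s s₁ s₂ t₁ t₂} : Runs p s s₁ t₁ → Runs q s₁ s₂ t₂ → Runs (seq p q) s s₂ (t₁ + t₂)
  | popCase {k f s s' t} : Runs (f (s k).head?) (update s k (s k).tail) s' t →
      Runs (popCase k f) s s' (t + 1)
  | loop_exit {k c f s} : (s k).head?.any c = false → Runs (loop k c f) s s 1
  | loop_step {k c f s a l s₁ s₂ t₁ t₂} : s k = a :: l → c a = true →
      Runs (f a) (update s k l) s₁ t₁ → Runs (loop k c f) s₁ s₂ t₂ →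
      Runs (loop k c f) s s₂ (t₁ + t₂ + 1)
  | mono {p s s' t t'} : Runs p s s' t → t ≤ t' → Runs p s s' t'

/-- Each constructor of `Runs` costs at most one machine step beyond its parts. The machine `M`, the
embedding `ι` and the exit `e` are arbitrary, so that the induction applies to subprograms inside a
larger program. The initial letter `v` is arbitrary too, because every program reads a letter before
it branches on it. -/
theorem Runs.reaches {p : Prog K Γ} {s s' : K → List Γ} {t : ℕ} (h : Runs p s s' t) :
    ∀ {Λ : Type} (M : Λ → TM2.Stmt (fun _ : K => Γ) Λ (Option Γ)) (ι : p.Label → Λ) (e : Λ),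
      (∀ l, M (ι l) = p.code ι e l) → ∀ v, ∃ v' n, n ≤ t ∧
        (flip bind (TM2.step M))^[n] (some ⟨some (ι p.entry), v, s⟩) =
          some ⟨some e, v', s'⟩ := by
  induction h with
  | nop s =>
    intro Λ M ι e hM v
    refine ⟨v, 1, le_rfl, ?_⟩
    simp [flip, hM, code]
  | push k a s =>
    intro Λ M ι e hM v
    refine ⟨v, 1, le_rfl, ?_⟩
    simp [flip, hM, code]
  | @seq p q s s₁ s₂ t₁ t₂ _ _ ih₁ ih₂ =>
    intro Λ M ι e hM v
    obtain ⟨v₁, n₁, hn₁, h₁⟩ := ih₁ M (fun l => ι (Sum.inl l)) (ι (Sum.inr q.entry))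
      (fun l => hM (Sum.inl l)) v
    obtain ⟨v₂, n₂, hn₂, h₂⟩ := ih₂ M (fun l => ι (Sum.inr l)) e (fun l => hM (Sum.inr l)) v₁
    refine ⟨v₂, n₂ + n₁, by omega, ?_⟩
    rw [iterate_add_apply]
    exact (congrArg _ h₁).trans h₂
  | @popCase k f s s' t _ ih =>
    intro Λ M ι e hM v
    obtain ⟨v', n, hn, h⟩ := ih M (fun l => ι (some ⟨_, l⟩)) e (fun l => hM (some ⟨_, l⟩))
      (s k).head?
    refine ⟨v', n + 1, by omega, ?_⟩
    rw [iterate_add_apply]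
    refine Eq.trans (congrArg _ ?_) h
    have h0 := hM none
    simp [code] at h0
    simp [flip, entry, h0]
  | @loop_exit k c f s hs =>
    intro Λ M ι e hM v
    refine ⟨(s k).head?, 1, le_rfl, ?_⟩
    have h0 := hM none
    simp [code] at h0
    simp [flip, entry, h0, hs]
  | @loop_step k c f s a l s₁ s₂ t₁ t₂ hs hc _ _ ih₁ ih₂ =>
    intro Λ M ι e hM v
    obtain ⟨v₁, n₁, hn₁, h₁⟩ := ih₁ M (fun l => ι (some ⟨a, l⟩)) (ι none)
      (fun l => hM (some ⟨a, l⟩)) (some a)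
    obtain ⟨v₂, n₂, hn₂, h₂⟩ := ih₂ M ι e hM v₁
    refine ⟨v₂, n₂ + n₁ + 1, by omega, ?_⟩
    rw [iterate_add_apply, iterate_add_apply]
    refine Eq.trans (congrArg _ (Eq.trans (congrArg _ ?_) h₁)) h₂
    have h0 := hM none
    simp [code] at h0
    simp [flip, entry, h0, hs, hc]
  | mono _ ht ih =>
    intro Λ M ι e hM v
    obtain ⟨v', n, hn, h⟩ := ih M ι e hM v
    exact ⟨v', n, hn.trans ht, h⟩

/-- The machine that executes a program and halts. -/
noncomputable def machine [Fintype K] [Fintype Γ] (p : Prog K Γ) (i o : K) : FinTM2 :=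
  have := p.finite_label
  { k₀ := i
    k₁ := o
    Γ := fun _ => Γ
    Λ := Option p.Label
    main := some p.entry
    ΛFin := Fintype.ofFinite _
    σ := Option Γ
    initialState := none
    m := fun l => l.elim (.load (fun _ => none) .halt) (p.code some none) }

/-- `initList` and `haltList` describe their stacks by a dependent `if`; this matches them with
`update`. -/
theorem update_nil_eq_dite (i : K) (l : List Γ) :
    update (fun _ => []) i l = fun k => if _h : k = i then l else [] := by
  funext k
  by_cases hk : k = i
  · subst hk; simp
  · simp [hk]

/-- A program that computes `f` yields a Turing machine that computes `f`. -/
theorem exists_tm2ComputableInTime [Fintype K] [Fintype Γ] {α β : Type} {ea : α → List Γ}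
    {eb : β → List Γ} {f : α → β} (p : Prog K Γ) (i o : K) (time : ℕ → ℕ)
    (h : ∀ a, Runs p (update (fun _ => []) i (ea a)) (update (fun _ => []) o (eb (f a)))
      (time (ea a).length)) :
    ∃ T : TM2ComputableInTime ea eb f, (∀ s, Finite (T.tm.Γ s)) ∧ ∀ k, T.time k = time k + 1 := by
  have key : ∀ a, ∃ n ≤ time (ea a).length + 1,
      (flip bind (p.machine i o).step)^[n] (some (initList (p.machine i o) (ea a))) =
        some (haltList (p.machine i o) (eb (f a))) := by
    intro a
    obtain ⟨v, n, hn, hr⟩ := (h a).reaches (p.machine i o).m some none (fun _ => rfl) none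
    have hi : initList (p.machine i o) (ea a) =
        ⟨some (some p.entry), none, update (fun _ => []) i (ea a)⟩ := by
      simp only [initList, machine]
      congr 1
      exact (update_nil_eq_dite i (ea a)).symm
    have ho : haltList (p.machine i o) (eb (f a)) =
        ⟨none, none, update (fun _ => []) o (eb (f a))⟩ := by
      simp only [haltList, machine]
      congr 1
      exact (update_nil_eq_dite o (eb (f a))).symm
    -- The additional step is taken at the label `none`, which resets the internal letter and halts.
    refine ⟨1 + n, by omega, ?_⟩
    rw [iterate_add_apply, hi, ho]
    refine Eq.trans (congrArg _ hr) ?_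
    rfl
  choose n hn hr using key
  exact ⟨{ tm := p.machine i o
           inputAlphabet := Equiv.refl Γ
           outputAlphabet := Equiv.refl Γ
           time := fun k => time k + 1
           outputsFun := fun a =>
            { steps := n a
              evals_in_steps := by
                have h := hr a
                rw [← List.map_id (ea a), ← List.map_id (eb (f a))] at h
                exact h
              steps_le_m := hn a } }, fun _ => (inferInstance : Finite Γ), fun _ => rfl⟩

end Prog

end StackProgram

namespace ModalDL

variable {n : ℕ}

/-! ### The translation -/

/-- The name of the atom for the subconcept at position `q`. -/
def posName (q : ℕ) : Name := false :: false :: List.replicate q true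

/-- The name of the atom for `∃r.D`, where `D` is the subconcept at position `q`. -/
def roleName (r : Name) (q : ℕ) : Name :=
  false :: true :: (List.replicate q true ++ false :: r)

/-- The name of the atom for the concept name `A`. -/
def conceptName (A : Name) : Name := true :: false :: A

/-- The name of the atom for the nominal of `a`. -/
def nominalName (a : Name) : Name := true :: true :: a

namespace LinConcept

/-- At a point that precedes all others, this says that `X` is included in `Y` at the others. -/
def inclusion (X Y : LinConcept n) : LinConcept n := .neg (.existsOrd (.and X (.neg Y)))

/-- Both inclusions between `X` and `Y`. -/
def equivalence (X Y : LinConcept n) : List (LinConcept n) := [inclusion X Y, inclusion Y X]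

/-- A valid concept. -/
def valid : LinConcept n := .neg (.and (.atom []) (.neg (.atom [])))

/-- The conjunction of the concepts in a list and a further concept. -/
def conjoin (L : List (LinConcept n)) (B : LinConcept n) : LinConcept n := L.foldr .and B

/-- The conjunction of `B` and of the negations of those `X (c + i + 1)` for which the entry `i` of
the list is `true`. -/
def negConj (X : ℕ → LinConcept n) : List Bool → ℕ → LinConcept n → LinConcept n
  | [], _, B => B
  | b :: S, c, B => negConj X S (c + 1) (if b then .and (.neg (X (c + 1))) B else B)

/-- `X` here and after every step along the relation `i`. -/
def boxStep (X : LinConcept n) (i : Fin n) : LinConcept n := .and X (.neg (.dia i (.neg X)))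

/-- Implies `X` here and after every step along any relation. -/
def boxRound (X : LinConcept n) : LinConcept n := (List.finRange n).foldl boxStep X

end LinConcept

open LinConcept

/-- The atom for the subconcept at position `q`. -/
def posAtom (q : ℕ) : LinConcept n := .atom (posName q)

/-- The atom for `∃r.D`, where `D` is the subconcept at position `q`. -/
def roleAtom (r : Name) (q : ℕ) : LinConcept n := .atom (roleName r q)

/-- The concept that stands for the nominal of `a`: the last element with a certain atom. -/
def lastNominal (a : Name) : LinConcept n :=
  .and (.atom (nominalName a)) (.neg (.existsOrd (.atom (nominalName a))))

/-- If some element satisfies `∃r.D`, with `D` at position `q`, and no `∃r.E` with `E` at a position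
selected by `S`, then some element satisfies `D` and no `E` at a position selected by `S`. -/
def witnessConstraint (S : List Bool) (r : Name) (q : ℕ) : LinConcept n :=
  .neg (.and (.existsOrd (negConj (roleAtom r) S 0 (roleAtom r q)))
    (.neg (.existsOrd (negConj posAtom S 0 (posAtom q)))))

/-- The constraint on the individual name `a`. -/
def nameConstraint (t : NameKind) (a : Name) : List (LinConcept n) :=
  match t with
  | .total => [.existsOrd (.atom (nominalName a))]
  | .partially => []

/-- The constraints on the atoms for the subconcepts of a concept that is followed by `m` letters.
The position of a subconcept is the number of letters from its first letter to the end. -/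
def constraints (t : NameKind) (S : List Bool) : Concept n → ℕ → List (LinConcept n)
  | .atom A, m => equivalence (posAtom (m + (Concept.atom A : Concept n).write.length))
      (.atom (conceptName A))
  | .nominal a, m => equivalence (posAtom (m + (Concept.nominal a : Concept n).write.length))
      (lastNominal a) ++ nameConstraint t a
  | .neg C, m => equivalence (posAtom (m + C.neg.write.length))
      (.neg (posAtom (m + C.write.length))) ++ constraints t S C m
  | .and C D, m => equivalence (posAtom (m + (C.and D).write.length))
      (.and (posAtom (m + D.write.length + C.write.length)) (posAtom (m + D.write.length))) ++
      (constraints t S C (m + D.write.length) ++ constraints t S D m)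
  | .existsRole r C, m => equivalence (posAtom (m + (C.existsRole r).write.length))
      (roleAtom r (m + C.write.length)) ++
      witnessConstraint S r (m + C.write.length) :: constraints t S C m
  | .existsUniv C, m =>
      .neg (.and (.existsOrd (posAtom (m + C.existsUniv.write.length)))
        (.neg (.existsOrd (posAtom (m + C.write.length))))) ::
      .neg (.and (.existsOrd (.neg (posAtom (m + C.existsUniv.write.length))))
        (.existsOrd (posAtom (m + C.write.length)))) :: constraints t S C m
  | .dia i C, m => equivalence (posAtom (m + (C.dia i).write.length))
      (.dia i (posAtom (m + C.write.length))) ++ constraints t S C m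

/-- The `k` lowest binary digits of `j`, the lowest one first. -/
def digits : ℕ → ℕ → List Bool
  | 0, _ => []
  | k + 1, j => j.bodd :: digits k j.div2

/-- The constraints for the selections given by the digits of the numbers below `j`. -/
def allConstraints (t : NameKind) (C : Concept n) : ℕ → LinConcept n
  | 0 => valid
  | j + 1 => conjoin (constraints t (digits C.write.length j) C 0) (allConstraints t C j)

/-- The translation of a concept. -/
def translate (t : NameKind) (C : Concept n) : LinConcept n :=
  .and (.existsOrd (posAtom C.write.length))
    (boxRound^[C.write.length] (allConstraints t C (2 ^ C.write.length)))

/-- Hence the numbers below `2 ^ k` enumerate all selections of length `k`, and `allConstraints`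
covers each of them. -/
theorem exists_digits_eq (S : List Bool) : ∃ j < 2 ^ S.length, digits S.length j = S := by
  induction S with
  | nil => exact ⟨0, by simp, rfl⟩
  | cons b S ih =>
    obtain ⟨j, hj, h⟩ := ih
    refine ⟨Nat.bit b j, ?_, ?_⟩
    · rw [Nat.bit_val, List.length_cons, pow_succ]
      cases b <;> simp <;> omega
    · simp [digits, Nat.bodd_bit, Nat.div2_bit, h]

/-! ### Semantics -/

theorem Interp.ext_subset_dom {F : Frame.{u} n} (M : Interp.{u, v} F) (C : Concept n)
    (w : F.World) : M.ext C w ⊆ M.dom w := by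
  intro d hd
  cases C with
  | atom A => exact M.concept_subset w A hd
  | nominal a => exact M.indiv_mem w a d hd
  | neg C => exact hd.1
  | and C D => exact M.ext_subset_dom C w hd.1
  | existsRole r C =>
    obtain ⟨e, h, _⟩ := hd
    exact (M.role_subset w r h).1
  | existsUniv C => exact hd.1
  | dia i C => exact hd.1

namespace LinInterp

variable {F : Frame.{u} n} (M : LinInterp.{u, v} F) {w : F.World} {d : M.Elt}
  {X Y B : LinConcept n}

theorem ext_subset_dom (X : LinConcept n) (w : F.World) : M.ext X w ⊆ M.dom w := by
  intro d hd
  cases X with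
  | atom A => exact M.concept_subset w A hd
  | neg C => exact hd.1
  | and C D => exact ext_subset_dom C w hd.1
  | existsOrd C => exact hd.1
  | dia i C => exact hd.1

theorem mem_ext_atom {A : Name} : d ∈ M.ext (.atom A) w ↔ d ∈ M.concept w A := Iff.rfl

theorem mem_ext_neg : d ∈ M.ext (.neg X) w ↔ d ∈ M.dom w ∧ d ∉ M.ext X w := Iff.rfl

theorem mem_ext_and : d ∈ M.ext (.and X Y) w ↔ d ∈ M.ext X w ∧ d ∈ M.ext Y w := Iff.rfl

theorem mem_ext_existsOrd : d ∈ M.ext (.existsOrd X) w ↔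
    d ∈ M.dom w ∧ ∃ e ∈ M.dom w, M.lt d e ∧ e ∈ M.ext X w := Iff.rfl

theorem mem_ext_dia {i : Fin n} : d ∈ M.ext (.dia i X) w ↔
    d ∈ M.dom w ∧ ∃ w', F.rel i w w' ∧ d ∈ M.ext X w' := Iff.rfl

theorem mem_ext_inclusion (hd : d ∈ M.dom w) : d ∈ M.ext (inclusion X Y) w ↔
    ∀ e ∈ M.dom w, M.lt d e → e ∈ M.ext X w → e ∈ M.ext Y w := by
  simp only [inclusion, mem_ext_neg, mem_ext_existsOrd, mem_ext_and]
  grind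

theorem forall_mem_equivalence (hd : d ∈ M.dom w) :
    (∀ Z ∈ equivalence X Y, d ∈ M.ext Z w) ↔
      ∀ e ∈ M.dom w, M.lt d e → (e ∈ M.ext X w ↔ e ∈ M.ext Y w) := by
  simp only [equivalence, List.forall_mem_cons, mem_ext_inclusion M hd]
  grind

theorem mem_ext_implication (hd : d ∈ M.dom w) :
    d ∈ M.ext (.neg (.and X (.neg Y))) w ↔ (d ∈ M.ext X w → d ∈ M.ext Y w) := by
  simp only [mem_ext_neg, mem_ext_and]
  grind

theorem mem_ext_valid (hd : d ∈ M.dom w) : d ∈ M.ext valid w :=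
  (M.mem_ext_implication hd).2 id

theorem mem_ext_conjoin {L : List (LinConcept n)} :
    d ∈ M.ext (conjoin L B) w ↔ (∀ X ∈ L, d ∈ M.ext X w) ∧ d ∈ M.ext B w := by
  induction L with
  | nil => simp [conjoin]
  | cons X L ih =>
    rw [List.forall_mem_cons, and_assoc, ← ih]
    rfl

theorem mem_ext_negConj {X : ℕ → LinConcept n} (hd : d ∈ M.dom w) (S : List Bool) (c : ℕ) :
    d ∈ M.ext (negConj X S c B) w ↔
      d ∈ M.ext B w ∧ ∀ i, S[i]? = some true → d ∉ M.ext (X (c + i + 1)) w := by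
  induction S generalizing c B with
  | nil => simp [negConj]
  | cons b S ih =>
    rw [negConj, ih]
    constructor
    · rintro ⟨h, h'⟩
      refine ⟨?_, fun i hi => ?_⟩
      · cases b
        · exact h
        · exact h.2
      · cases i with
        | zero =>
          obtain rfl : b = true := by simpa using hi
          exact h.1.2
        | succ i =>
          have := h' i (by simpa using hi)
          rwa [show c + 1 + i + 1 = c + (i + 1) + 1 by omega] at this
    · rintro ⟨h, h'⟩
      refine ⟨?_, fun i hi => ?_⟩
      · cases b
        · exact h
        · exact ⟨⟨hd, h' 0 rfl⟩, h⟩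
      · have := h' (i + 1) (by simpa using hi)
        rwa [show c + (i + 1) + 1 = c + 1 + i + 1 by omega] at this

theorem mem_ext_boxStep {i : Fin n} : d ∈ M.ext (boxStep X i) w ↔
    d ∈ M.ext X w ∧ ∀ w', F.rel i w w' → d ∈ M.ext X w' := by
  simp only [boxStep, mem_ext_neg, mem_ext_and, mem_ext_dia]
  constructor
  · rintro ⟨h, hd, h'⟩
    refine ⟨h, fun w' hw' => ?_⟩
    by_contra hn
    -- Since domains do not shrink, `d` still exists at `w'`, so not satisfying `X` there means
    -- satisfying its negation.
    exact h' ⟨hd, w', hw', M.dom_mono i w w' hw' hd, hn⟩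
  · rintro ⟨h, h'⟩
    exact ⟨h, M.ext_subset_dom X w h, fun ⟨_, w', hw', _, hn⟩ => hn (h' w' hw')⟩

theorem of_mem_ext_foldl_boxStep (l : List (Fin n)) (h : d ∈ M.ext (l.foldl boxStep X) w) :
    d ∈ M.ext X w ∧ ∀ i ∈ l, ∀ w', F.rel i w w' → d ∈ M.ext X w' := by
  induction l generalizing X with
  | nil => exact ⟨h, by simp⟩
  | cons i l ih =>
    obtain ⟨h₁, h₂⟩ := ih h
    rw [mem_ext_boxStep] at h₁
    refine ⟨h₁.1, List.forall_mem_cons.2 ⟨h₁.2, fun j hj w' hw' => ?_⟩⟩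
    exact ((M.mem_ext_boxStep).1 (h₂ j hj w' hw')).1

theorem of_mem_ext_boxRound (h : d ∈ M.ext (boxRound X) w) :
    d ∈ M.ext X w ∧ ∀ i w', F.rel i w w' → d ∈ M.ext X w' := by
  obtain ⟨h₁, h₂⟩ := M.of_mem_ext_foldl_boxStep _ h
  exact ⟨h₁, fun i => h₂ i (List.mem_finRange i)⟩

theorem mem_ext_boxRound (h : ∀ w, d ∈ M.ext X w) (w : F.World) : d ∈ M.ext (boxRound X) w := by
  have (l : List (Fin n)) : ∀ w, d ∈ M.ext (l.foldl boxStep X) w := by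
    induction l generalizing X with
    | nil => exact h
    | cons i l ih => exact ih fun w => M.mem_ext_boxStep.2 ⟨h w, fun w' _ => h w'⟩
  exact this _ w

theorem mem_ext_boxRound_iterate (h : ∀ w, d ∈ M.ext X w) (j : ℕ) (w : F.World) :
    d ∈ M.ext (boxRound^[j] X) w := by
  induction j generalizing X with
  | zero => exact h w
  | succ j ih =>
    rw [Function.iterate_succ_apply]
    exact ih (M.mem_ext_boxRound h)

theorem mem_ext_allConstraints {t : NameKind} {C : Concept n} (hd : d ∈ M.dom w) (j : ℕ) :
    d ∈ M.ext (allConstraints t C j) w ↔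
      ∀ i < j, ∀ X ∈ constraints t (digits C.write.length i) C 0, d ∈ M.ext X w := by
  induction j with
  | zero => simpa [allConstraints] using M.mem_ext_valid hd
  | succ j ih =>
    rw [allConstraints, mem_ext_conjoin, ih]
    constructor
    · rintro ⟨h, h'⟩ i hi
      rcases Nat.lt_succ_iff_lt_or_eq.1 hi with hi | rfl
      · exact h' i hi
      · exact h
    · exact fun h => ⟨h j (by omega), fun i hi => h i (by omega)⟩

end LinInterp

end ModalDL

namespace ModalDL

variable {n : ℕ}

open LinConcept

/-! ### From models of a concept to models of its translation -/

/-- The concept `D` occurs in the word `W` at position `q`, counted from the end. -/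
def OccursAt (W : List (Letter n)) (q : ℕ) (D : Concept n) : Prop :=
  ∃ s, (D.write ++ s).length = q ∧ D.write ++ s <:+ W

/-- The notation is a prefix code, so the suffix of a given length starts with at most one concept.
Therefore a position determines its subconcept, and atoms can be indexed by positions. -/
theorem OccursAt.unique {W : List (Letter n)} {q : ℕ} {D E : Concept n} (hD : OccursAt W q D)
    (hE : OccursAt W q E) : D = E := by
  obtain ⟨s, hs, hsW⟩ := hD
  obtain ⟨s', hs', hsW'⟩ := hE
  refine (Concept.write_append_inj D E s s' ?_).1
  exact (List.suffix_of_suffix_length_le hsW hsW' (by omega)).eq_of_length (by omega)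

theorem posName_inj {q q' : ℕ} : posName q = posName q' ↔ q = q' := by
  refine ⟨fun h => ?_, congrArg _⟩
  simpa [posName] using congrArg List.length h

theorem roleName_inj {r r' : Name} {q q' : ℕ} :
    roleName r q = roleName r' q' ↔ r = r' ∧ q = q' := by
  refine ⟨fun h => ?_, fun h => by rw [h.1, h.2]⟩
  simp only [roleName, List.cons.injEq, true_and] at h
  induction q generalizing q' with
  | zero => cases q' <;> simp_all [List.replicate_succ]
  | succ q ih =>
    cases q' with
    | zero => simp [List.replicate_succ] at h
    | succ q' => simpa using ih (by simpa [List.replicate_succ] using h)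

namespace Interp

variable {F : Frame.{u} n} (M : Interp.{u, v} F) (W : List (Letter n))

/-- The meaning of an atom of the translation in a given model. -/
def Holds (w : F.World) (B : Name) (d : M.Elt) : Prop :=
  (∃ q D, B = posName q ∧ OccursAt W q D ∧ d ∈ M.ext D w) ∨
  (∃ r q D, B = roleName r q ∧ OccursAt W q D ∧ d ∈ M.ext (.existsRole r D) w) ∨
  (∃ A, B = conceptName A ∧ d ∈ M.concept w A) ∨
  (∃ a, B = nominalName a ∧ M.indiv w a = some d)

/-- The reverse of a well-order with one point added at its top: strict and linear, with the added
point first. -/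
theorem isStrictTotalOrder_lex (α : Type v) : IsStrictTotalOrder (α ⊕ PUnit.{v + 1})
    (fun x y => Sum.Lex WellOrderingRel emptyRelation y x) :=
  inferInstanceAs (IsStrictTotalOrder _ (Function.swap (Sum.Lex WellOrderingRel emptyRelation)))

/-- The model of the translation: a first point is added in front of all elements. -/
def toLin : LinInterp.{u, v} F where
  Elt := M.Elt ⊕ PUnit.{v + 1}
  -- The condition is vacuous for the added point, which thus belongs to every domain; this keeps
  -- constant domains constant.
  dom w := {x | ∀ d, x = Sum.inl d → d ∈ M.dom w}
  dom_nonempty w := ⟨Sum.inr ⟨⟩, by simp⟩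
  dom_mono i w w' h x hx d hd := M.dom_mono i w w' h (hx d hd)
  concept w B := {x | ∃ d ∈ M.dom w, x = Sum.inl d ∧ M.Holds W w B d}
  concept_subset w B := by
    rintro _ ⟨d, hd, rfl, _⟩ d' h
    rwa [← Sum.inl.inj h]
  -- The arguments are exchanged: well-foundedness of the sum becomes the absence of ascending
  -- chains, and the top of the sum becomes the first point.
  lt x y := Sum.Lex WellOrderingRel emptyRelation y x
  lt_strictTotalOrder := isStrictTotalOrder_lex M.Elt
  lt_noetherian := (inferInstance : IsWellFounded (M.Elt ⊕ PUnit.{v + 1})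
    (Sum.Lex WellOrderingRel emptyRelation)).wf

variable {M W} {w : F.World} {d : M.Elt} {X Y : LinConcept n}

/-- The first point. -/
def first (M : Interp.{u, v} F) (W : List (Letter n)) : (M.toLin W).Elt := Sum.inr ⟨⟩

/-- An element of the given model, as an element of the model of the translation. -/
def embed (M : Interp.{u, v} F) (W : List (Letter n)) (d : M.Elt) : (M.toLin W).Elt := Sum.inl d

theorem embed_mem_dom : M.embed W d ∈ (M.toLin W).dom w ↔ d ∈ M.dom w :=
  ⟨fun h => h d rfl, fun h _ he => Sum.inl.inj he ▸ h⟩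

theorem first_mem_dom : M.first W ∈ (M.toLin W).dom w := by
  rintro _ ⟨⟩

theorem first_lt_embed : (M.toLin W).lt (M.first W) (M.embed W d) := Sum.Lex.sep _ _

/-- All elements of the given model come after the first point and nothing else does, so `∃o` at
that point quantifies over exactly the original domain. -/
theorem exists_first_lt {p : (M.toLin W).Elt → Prop} :
    (∃ e ∈ (M.toLin W).dom w, (M.toLin W).lt (M.first W) e ∧ p e) ↔
      ∃ d ∈ M.dom w, p (M.embed W d) := by
  constructor
  · rintro ⟨d | ⟨⟨⟩⟩, hd, hlt, hp⟩
    · exact ⟨d, embed_mem_dom.1 hd, hp⟩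
    · cases hlt with
      | inr h => exact h.elim
  · rintro ⟨d, hd, hp⟩
    exact ⟨M.embed W d, embed_mem_dom.2 hd, first_lt_embed, hp⟩

theorem forall_first_lt {p : (M.toLin W).Elt → Prop} :
    (∀ e ∈ (M.toLin W).dom w, (M.toLin W).lt (M.first W) e → p e) ↔
      ∀ d ∈ M.dom w, p (M.embed W d) := by
  have := exists_first_lt (M := M) (W := W) (w := w) (p := fun e => ¬ p e)
  grind

theorem first_mem_existsOrd : M.first W ∈ (M.toLin W).ext (.existsOrd X) w ↔
    ∃ d ∈ M.dom w, M.embed W d ∈ (M.toLin W).ext X w := by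
  rw [LinInterp.mem_ext_existsOrd, exists_first_lt]
  exact and_iff_right first_mem_dom

theorem forall_first_mem_equivalence :
    (∀ Z ∈ equivalence X Y, M.first W ∈ (M.toLin W).ext Z w) ↔
      ∀ d ∈ M.dom w, (M.embed W d ∈ (M.toLin W).ext X w ↔ M.embed W d ∈ (M.toLin W).ext Y w) := by
  rw [LinInterp.forall_mem_equivalence _ first_mem_dom]
  exact forall_first_lt

theorem embed_mem_ext_atom {B : Name} :
    M.embed W d ∈ (M.toLin W).ext (.atom B) w ↔ d ∈ M.dom w ∧ M.Holds W w B d := by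
  constructor
  · rintro ⟨_, hd, h, h'⟩
    cases h
    exact ⟨hd, h'⟩
  · exact fun ⟨hd, h⟩ => ⟨d, hd, rfl, h⟩

theorem embed_mem_posAtom {q : ℕ} {D : Concept n} (h : OccursAt W q D) :
    M.embed W d ∈ (M.toLin W).ext (posAtom q) w ↔ d ∈ M.ext D w := by
  rw [posAtom, embed_mem_ext_atom]
  constructor
  · rintro ⟨_, ⟨q', D', hq, h', hd⟩ | ⟨_, _, _, hq, _⟩ | ⟨_, hq, _⟩ | ⟨_, hq, _⟩⟩
    · rw [posName_inj] at hq
      subst hq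
      rwa [h.unique h']
    all_goals simp [posName, roleName, conceptName, nominalName] at hq
  · exact fun hd => ⟨M.ext_subset_dom _ _ hd, Or.inl ⟨q, D, rfl, h, hd⟩⟩

/-- A selection may contain positions at which no subconcept begins; their atoms are false
everywhere, so they do no harm. -/
theorem of_embed_mem_posAtom {q : ℕ} (h : M.embed W d ∈ (M.toLin W).ext (posAtom q) w) :
    ∃ D, OccursAt W q D := by
  rw [posAtom, embed_mem_ext_atom] at h
  obtain ⟨_, ⟨q', D', hq, h', hd⟩ | ⟨_, _, _, hq, _⟩ | ⟨_, hq, _⟩ | ⟨_, hq, _⟩⟩ := h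
  · rw [posName_inj] at hq
    subst hq
    exact ⟨_, h'⟩
  all_goals simp [posName, roleName, conceptName, nominalName] at hq

theorem embed_mem_roleAtom {r : Name} {q : ℕ} {D : Concept n} (h : OccursAt W q D) :
    M.embed W d ∈ (M.toLin W).ext (roleAtom r q) w ↔ d ∈ M.ext (.existsRole r D) w := by
  rw [roleAtom, embed_mem_ext_atom]
  constructor
  · rintro ⟨_, ⟨_, _, hq, _⟩ | ⟨r', q', D', hq, h', hd⟩ | ⟨_, hq, _⟩ | ⟨_, hq, _⟩⟩
    · simp [posName, roleName] at hq
    · rw [roleName_inj] at hq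
      obtain ⟨rfl, rfl⟩ := hq
      rwa [h.unique h']
    all_goals simp [roleName, conceptName, nominalName] at hq
  · exact fun hd => ⟨M.ext_subset_dom _ _ hd, Or.inr (Or.inl ⟨r, q, D, rfl, h, hd⟩)⟩

theorem embed_mem_conceptName {A : Name} :
    M.embed W d ∈ (M.toLin W).ext (.atom (conceptName A)) w ↔ d ∈ M.concept w A := by
  rw [embed_mem_ext_atom]
  constructor
  · rintro ⟨_, ⟨_, _, hq, _⟩ | ⟨_, _, _, hq, _⟩ | ⟨_, hq, hd⟩ | ⟨_, hq, _⟩⟩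
    · simp [posName, conceptName] at hq
    · simp [roleName, conceptName] at hq
    · simp only [conceptName, List.cons.injEq, true_and] at hq
      rwa [hq]
    · simp [nominalName, conceptName] at hq
  · exact fun hd => ⟨M.concept_subset _ _ hd, Or.inr (Or.inr (Or.inl ⟨A, rfl, hd⟩))⟩

theorem embed_mem_nominalName {a : Name} :
    M.embed W d ∈ (M.toLin W).ext (.atom (nominalName a)) w ↔ M.indiv w a = some d := by
  rw [embed_mem_ext_atom]
  constructor
  · rintro ⟨_, ⟨_, _, hq, _⟩ | ⟨_, _, _, hq, _⟩ | ⟨_, hq, hd⟩ | ⟨_, hq, hd⟩⟩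
    · simp [posName, nominalName] at hq
    · simp [roleName, nominalName] at hq
    · simp [nominalName, conceptName] at hq
    · simp only [nominalName, List.cons.injEq, true_and] at hq
      rwa [hq]
  · exact fun hd => ⟨M.indiv_mem _ _ _ hd, Or.inr (Or.inr (Or.inr ⟨a, rfl, hd⟩))⟩

/-- At most one element carries the atom for `a`, so it is automatically the last one, whatever the
order is. -/
theorem embed_mem_lastNominal {a : Name} :
    M.embed W d ∈ (M.toLin W).ext (lastNominal a) w ↔ M.indiv w a = some d := by
  rw [lastNominal, LinInterp.mem_ext_and, embed_mem_nominalName, and_iff_left_of_imp]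
  intro h
  refine ⟨embed_mem_dom.2 (M.indiv_mem _ _ _ h), ?_⟩
  rintro ⟨_, e | e, _, hlt, he⟩
  · have he := embed_mem_nominalName.1 he
    rw [h] at he
    cases he
    exact (M.toLin W).lt_strictTotalOrder.irrefl _ hlt
  · obtain ⟨_, _, h, _⟩ := he
    cases h

/-- A true `r`-successor of `d` in `D` serves as the witness: if it satisfied a selected `E`, then
`d` would satisfy `∃r.E`, which the selection excludes. -/
theorem first_mem_witnessConstraint {r : Name} {q : ℕ} {D : Concept n} (h : OccursAt W q D)
    (S : List Bool) : M.first W ∈ (M.toLin W).ext (witnessConstraint S r q) w := by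
  rw [witnessConstraint, LinInterp.mem_ext_implication _ first_mem_dom, first_mem_existsOrd,
    first_mem_existsOrd]
  rintro ⟨d, hd, hX⟩
  rw [LinInterp.mem_ext_negConj _ (embed_mem_dom.2 hd), embed_mem_roleAtom h] at hX
  obtain ⟨⟨e, hde, he⟩, hS⟩ := hX
  have hed := M.ext_subset_dom _ _ he
  refine ⟨e, hed, ?_⟩
  rw [LinInterp.mem_ext_negConj _ (embed_mem_dom.2 hed), embed_mem_posAtom h]
  refine ⟨he, fun i hi he' => hS i hi ?_⟩
  obtain ⟨E, hE⟩ := of_embed_mem_posAtom he'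
  rw [embed_mem_roleAtom hE]
  exact ⟨e, hde, (embed_mem_posAtom hE).1 he'⟩

/-- Each constraint restates the semantic clause of its subconcept. The induction runs over the
suffixes of `W` that begin with `D`, so that the offset passed to `constraints` agrees with the
positions in `OccursAt`. -/
theorem first_mem_constraints {t : NameKind} (ht : t.Admits M) (S : List Bool) (D : Concept n) :
    ∀ s, D.write ++ s <:+ W → ∀ X ∈ constraints t S D s.length, ∀ w,
      M.first W ∈ (M.toLin W).ext X w := by
  have occ {E : Concept n} {s : List (Letter n)} (h : E.write ++ s <:+ W) :
      OccursAt W (s.length + E.write.length) E := ⟨s, by simp [Nat.add_comm], h⟩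
  induction D with
  | atom A =>
    intro s hs X hX w
    refine forall_first_mem_equivalence.2 (fun d _ => ?_) X hX
    rw [embed_mem_posAtom (occ hs), embed_mem_conceptName]
    rfl
  | nominal a =>
    intro s hs X hX w
    rw [constraints, List.mem_append] at hX
    rcases hX with hX | hX
    · refine forall_first_mem_equivalence.2 (fun d _ => ?_) X hX
      rw [embed_mem_posAtom (occ hs), embed_mem_lastNominal]
      rfl
    · cases t with
      | total =>
        obtain rfl : X = _ := by simpa [nameConstraint] using hX
        obtain ⟨d, hd⟩ := ht w a
        exact first_mem_existsOrd.2 ⟨d, M.indiv_mem _ _ _ hd, embed_mem_nominalName.2 hd⟩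
      | partially => simp [nameConstraint] at hX
  | neg C ih =>
    intro s hs X hX w
    have hC : C.write ++ s <:+ W := (List.suffix_cons _ _).trans hs
    rw [constraints, List.mem_append] at hX
    rcases hX with hX | hX
    · refine forall_first_mem_equivalence.2 (fun d _ => ?_) X hX
      rw [embed_mem_posAtom (occ hs), LinInterp.mem_ext_neg, embed_mem_posAtom (occ hC), embed_mem_dom]
      rfl
    · exact ih s hC X hX w
  | and C D ihC ihD =>
    intro s hs X hX w
    have hC : C.write ++ (D.write ++ s) <:+ W := by
      refine (List.suffix_cons Letter.and _).trans ?_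
      simpa [Concept.write] using hs
    have hD : D.write ++ s <:+ W := (List.suffix_append _ _).trans hC
    have hl : (D.write ++ s).length = s.length + D.write.length := by simp [Nat.add_comm]
    rw [constraints, List.mem_append, List.mem_append] at hX
    rcases hX with hX | hX | hX
    · refine forall_first_mem_equivalence.2 (fun d _ => ?_) X hX
      rw [embed_mem_posAtom (occ hs), LinInterp.mem_ext_and, ← hl, embed_mem_posAtom (occ hC), hl,
        embed_mem_posAtom (occ hD)]
      rfl
    · exact ihC _ hC X (hl ▸ hX) w
    · exact ihD s hD X hX w
  | existsRole r C ih =>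
    intro s hs X hX w
    have hC : C.write ++ s <:+ W := by
      refine ((List.suffix_append (writeName r) _).trans (List.suffix_cons Letter.existsRole _)).trans
        ?_
      simpa [Concept.write] using hs
    rw [constraints, List.mem_append, List.mem_cons] at hX
    rcases hX with hX | rfl | hX
    · refine forall_first_mem_equivalence.2 (fun d _ => ?_) X hX
      rw [embed_mem_posAtom (occ hs), embed_mem_roleAtom (occ hC)]
    · exact first_mem_witnessConstraint (occ hC) S
    · exact ih s hC X hX w
  | existsUniv C ih =>
    intro s hs X hX w
    have hC : C.write ++ s <:+ W := (List.suffix_cons _ _).trans hs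
    have huniv {d : M.Elt} : d ∈ M.ext C.existsUniv w ↔
        d ∈ M.dom w ∧ ∃ e ∈ M.dom w, e ∈ M.ext C w := Iff.rfl
    rw [constraints, List.mem_cons, List.mem_cons] at hX
    rcases hX with rfl | rfl | hX
    · rw [LinInterp.mem_ext_implication _ first_mem_dom, first_mem_existsOrd, first_mem_existsOrd]
      simp only [embed_mem_posAtom (occ hs), embed_mem_posAtom (occ hC), huniv]
      exact fun ⟨_, _, _, h⟩ => h
    · rw [LinInterp.mem_ext_neg, LinInterp.mem_ext_and, first_mem_existsOrd, first_mem_existsOrd]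
      simp only [LinInterp.mem_ext_neg, embed_mem_posAtom (occ hs), embed_mem_posAtom (occ hC), huniv]
      exact ⟨first_mem_dom, fun ⟨⟨d, hd, _, h⟩, h'⟩ => h ⟨hd, h'⟩⟩
    · exact ih s hC X hX w
  | dia i C ih =>
    intro s hs X hX w
    have hC : C.write ++ s <:+ W := (List.suffix_cons _ _).trans hs
    rw [constraints, List.mem_append] at hX
    rcases hX with hX | hX
    · refine forall_first_mem_equivalence.2 (fun d _ => ?_) X hX
      rw [embed_mem_posAtom (occ hs), LinInterp.mem_ext_dia, embed_mem_dom]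
      simp only [embed_mem_posAtom (occ hC)]
      rfl
    · exact ih s hC X hX w

end Interp

theorem Concept.Satisfiable.translate {𝒞 : Set (Frame.{u} n)} {k : DomainKind} {t : NameKind}
    {C : Concept n} (h : Concept.Satisfiable.{u, v} 𝒞 k t C) :
    LinConcept.Satisfiable.{u, v} 𝒞 k (translate t C) := by
  obtain ⟨F, hF, M, hk, ht, w, d, hd⟩ := h
  refine ⟨F, hF, M.toLin C.write, ?_, w, M.first C.write, ?_⟩
  · cases k with
    | constant =>
      intro w w'
      simp only [Interp.toLin, hk w w']
    | expanding => trivial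
  · refine ⟨?_, ?_⟩
    · refine Interp.first_mem_existsOrd.2 ⟨d, M.ext_subset_dom _ _ hd, ?_⟩
      exact (Interp.embed_mem_posAtom ⟨[], by simp, by simp⟩).2 hd
    · refine LinInterp.mem_ext_boxRound_iterate _ (fun w => ?_) _ w
      rw [LinInterp.mem_ext_allConstraints _ Interp.first_mem_dom]
      exact fun i _ X hX => Interp.first_mem_constraints ht _ C [] (by simp) X hX w

end ModalDL

namespace ModalDL

variable {n : ℕ}

open LinConcept

/-! ### From models of the translation to models of the concept -/

namespace LinInterp

variable {F : Frame.{u} n} (M : LinInterp.{u, v} F) (t : NameKind) (d₀ e₀ : M.Elt)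
  (G : F.World → Prop) (k : ℕ)

/-- The elements after `d₀` at the worlds in `G`, and the element `e₀`. -/
def carrier (w : F.World) : Set M.Elt := {e | e = e₀ ∨ (G w ∧ e ∈ M.dom w ∧ M.lt d₀ e)}

/-- The element `e` is the last one of the carrier that satisfies the atom for `a`. -/
def IsLast (w : F.World) (a : Name) (e : M.Elt) : Prop :=
  e ∈ M.carrier d₀ e₀ G w ∧ e ∈ M.concept w (nominalName a) ∧
    ∀ e' ∈ M.carrier d₀ e₀ G w, M.lt e e' → e' ∉ M.concept w (nominalName a)

open scoped Classical in
/-- The model that is described by a model of the translation. -/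
noncomputable def decode (hG : ∀ i w w', F.rel i w w' → G w → G w') : Interp.{u, v} F where
  Elt := M.Elt
  dom := M.carrier d₀ e₀ G
  dom_nonempty w := ⟨e₀, Or.inl rfl⟩
  dom_mono i w w' h e he :=
    he.imp id fun ⟨h₁, h₂, h₃⟩ => ⟨hG i w w' h h₁, M.dom_mono i w w' h h₂, h₃⟩
  concept w A := {e | e ∈ M.carrier d₀ e₀ G w ∧ e ∈ M.concept w (conceptName A)}
  concept_subset w A e he := he.1
  -- The largest relation for which having a successor in a subconcept forces the corresponding role
  -- atom. Positions start at 1, hence `i + 1`.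
  role w r := {p | p.1 ∈ M.carrier d₀ e₀ G w ∧ p.2 ∈ M.carrier d₀ e₀ G w ∧
    ∀ i < k, p.2 ∈ M.concept w (posName (i + 1)) → p.1 ∈ M.concept w (roleName r (i + 1))}
  role_subset w r p hp := ⟨hp.1, hp.2.1⟩
  indiv w a := if h : ∃ e, M.IsLast d₀ e₀ G w a e then some h.choose else
    match t with
    -- At worlds that the boxes do not reach, the constraint on names may fail, yet a total name
    -- must denote something; `e₀` lies in every domain.
    | .total => some e₀
    | .partially => none
  indiv_mem w a d h := by
    split_ifs at h with h'
    · cases h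
      exact h'.choose_spec.1
    · cases t <;> cases h
      exact Or.inl rfl

variable {M t d₀ e₀ G k} {hG : ∀ i w w', F.rel i w w' → G w → G w'} {w : F.World} {e : M.Elt}

theorem decode_admits : t.Admits (M.decode t d₀ e₀ G k hG) := by
  cases t with
  | total =>
    intro w a
    simp only [decode]
    split_ifs with h
    · exact ⟨_, rfl⟩
    · exact ⟨_, rfl⟩
  | partially => trivial

theorem isLast_unique {a : Name} {e e' : M.Elt} (h : M.IsLast d₀ e₀ G w a e)
    (h' : M.IsLast d₀ e₀ G w a e') : e = e' := by
  by_contra hne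
  have := M.lt_strictTotalOrder
  rcases (trichotomous_of M.lt e e').resolve_right (by
    rintro (h₁ | h₁)
    · exact hne h₁
    · exact h'.2.2 _ h.1 h₁ h.2.1) with h₁
  exact h.2.2 _ h'.1 h₁ h'.2.1

theorem decode_indiv_eq {a : Name} (ht : t = .total → ∃ e, M.IsLast d₀ e₀ G w a e) :
    (M.decode t d₀ e₀ G k hG).indiv w a = some e ↔ M.IsLast d₀ e₀ G w a e := by
  simp only [decode]
  split_ifs with h
  · rw [Option.some_inj]
    exact ⟨fun h' => h' ▸ h.choose_spec, fun h' => isLast_unique h.choose_spec h'⟩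
  · cases t with
    | total => exact absurd (ht rfl) h
    | partially => simpa using fun h' => h ⟨e, h'⟩

theorem mem_carrier (he₀ : ∀ w, G w → e₀ ∈ M.dom w) (hlt : M.lt d₀ e₀) (hw : G w) :
    e ∈ M.carrier d₀ e₀ G w ↔ e ∈ M.dom w ∧ M.lt d₀ e :=
  ⟨fun h => h.elim (fun h => h ▸ ⟨he₀ w hw, hlt⟩) And.right, fun h => Or.inr ⟨hw, h⟩⟩

/-- This is the place where the Noetherian property is used: a non-empty set of elements has a last
one. -/
theorem exists_isLast {a : Name} (h : ∃ e ∈ M.carrier d₀ e₀ G w, e ∈ M.concept w (nominalName a)) :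
    ∃ e, M.IsLast d₀ e₀ G w a e := by
  obtain ⟨e, ⟨h₁, h₂⟩, h₃⟩ := M.lt_noetherian.has_min
    {e | e ∈ M.carrier d₀ e₀ G w ∧ e ∈ M.concept w (nominalName a)} h
  exact ⟨e, h₁, h₂, fun e' h₁' hlt h₂' => h₃ e' ⟨h₁', h₂'⟩ hlt⟩

/-- The concept looks at all later elements of the domain, `IsLast` only at those of the carrier. By
transitivity everything after `e` is after `d₀`, so the two agree. -/
theorem mem_ext_lastNominal {a : Name} (he₀ : ∀ w, G w → e₀ ∈ M.dom w) (hlt : M.lt d₀ e₀)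
    (hw : G w) (he : e ∈ M.carrier d₀ e₀ G w) :
    e ∈ M.ext (lastNominal a) w ↔ M.IsLast d₀ e₀ G w a e := by
  have := M.lt_strictTotalOrder
  have he' := (mem_carrier he₀ hlt hw).1 he
  rw [lastNominal, mem_ext_and, mem_ext_neg, mem_ext_existsOrd, mem_ext_atom, IsLast,
    and_iff_right he, and_iff_right he'.1]
  refine and_congr_right fun _ => ⟨fun h e' h' hee' hN => ?_, ?_⟩
  · exact h ⟨he'.1, e', ((mem_carrier he₀ hlt hw).1 h').1, hee', hN⟩
  · rintro h ⟨_, e', h', hee', hN⟩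
    exact h e' ((mem_carrier he₀ hlt hw).2 ⟨h', _root_.trans he'.2 hee'⟩) hee' hN

/-- The constraints for all selections are satisfied by `d₀` at all worlds that can be reached from
`w` in at most `j` steps. -/
def Good (M : LinInterp.{u, v} F) (t : NameKind) (d₀ : M.Elt) (G : F.World → Prop) (C : Concept n)
    (j : ℕ) (w : F.World) : Prop :=
  G w ∧ d₀ ∈ M.ext (boxRound^[j] (allConstraints t C (2 ^ C.write.length))) w

variable {C : Concept n}

theorem Good.succ {j : ℕ} (h : M.Good t d₀ G C (j + 1) w) : M.Good t d₀ G C j w := by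
  have h' := h.2
  rw [Function.iterate_succ_apply'] at h'
  exact ⟨h.1, (M.of_mem_ext_boxRound h').1⟩

theorem Good.rel {j : ℕ} {i : Fin n} {w' : F.World}
    (hG : ∀ i w w', F.rel i w w' → G w → G w') (h : M.Good t d₀ G C (j + 1) w)
    (hw : F.rel i w w') : M.Good t d₀ G C j w' := by
  have h' := h.2
  rw [Function.iterate_succ_apply'] at h'
  exact ⟨hG i w w' hw h.1, (M.of_mem_ext_boxRound h').2 i w' hw⟩

theorem Good.mem_dom {j : ℕ} (h : M.Good t d₀ G C j w) : d₀ ∈ M.dom w :=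
  M.ext_subset_dom _ _ h.2

theorem Good.constraints {j : ℕ} (h : M.Good t d₀ G C j w) {S : List Bool}
    (hS : S.length = C.write.length) {X : LinConcept n} (hX : X ∈ constraints t S C 0) :
    d₀ ∈ M.ext X w := by
  induction j with
  | zero =>
    obtain ⟨j, hj, hjS⟩ := exists_digits_eq S
    rw [hS] at hj hjS
    exact (M.mem_ext_allConstraints h.mem_dom _).1 h.2 j hj X (hjS ▸ hX)
  | succ j ih => exact ih h.succ

/-- The meaning of `witnessConstraint` for all selections together. -/
theorem exists_witness (hd : d₀ ∈ M.dom w) {r : Name} {q : ℕ}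
    (h : ∀ S : List Bool, S.length = k → d₀ ∈ M.ext (witnessConstraint S r q) w)
    (he : e ∈ M.dom w) (hlt : M.lt d₀ e) (heq : e ∈ M.concept w (roleName r q)) :
    ∃ e' ∈ M.dom w, M.lt d₀ e' ∧ e' ∈ M.concept w (posName q) ∧
      ∀ i < k, e' ∈ M.concept w (posName (i + 1)) → e ∈ M.concept w (roleName r (i + 1)) := by
  classical
  -- The selection consists of exactly the positions whose role atom fails at `e`. A witness that
  -- avoids all of them is a legitimate successor of `e` in the decoded model.
  set S : List Bool := List.ofFn fun i : Fin k => decide (e ∉ M.concept w (roleName r (i + 1)))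
    with hS
  have h := h S (by simp [hS])
  rw [witnessConstraint, mem_ext_implication _ hd, mem_ext_existsOrd, mem_ext_existsOrd] at h
  have hX : e ∈ M.ext (negConj (roleAtom r) S 0 (roleAtom r q)) w := by
    rw [mem_ext_negConj _ he]
    refine ⟨heq, fun i hi hn => ?_⟩
    obtain ⟨hi, hn'⟩ : ∃ _ : i < k, e ∉ M.concept w (roleName r (i + 1)) := by
      simpa [hS, List.getElem?_ofFn] using hi
    rw [Nat.zero_add] at hn
    exact hn' hn
  obtain ⟨_, e', he', hlt', hY⟩ := h ⟨hd, e, he, hlt, hX⟩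
  rw [mem_ext_negConj _ he'] at hY
  refine ⟨e', he', hlt', hY.1, fun i hi hp => ?_⟩
  by_contra hn
  refine hY.2 i (by simp [hS, hi, hn]) ?_
  rwa [Nat.zero_add]

/-- The truth lemma: on the carrier, position atoms are true to the decoded semantics, because the
constraints enforce the clauses for elements after `d₀`. The number `j` is a budget of remaining
boxes; the length of `D` bounds its modal depth, and only a diamond consumes a box. The inclusion of
the constraints of `D` among those of `C` makes the induction go through for subconcepts. -/
theorem mem_decode_ext (he₀ : ∀ w, G w → e₀ ∈ M.dom w) (hlt : M.lt d₀ e₀)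
    (D : Concept n) : ∀ m, m + D.write.length ≤ C.write.length →
      (∀ S : List Bool, ∀ X ∈ constraints t S D m, X ∈ constraints t S C 0) →
      ∀ j w, D.write.length ≤ j → M.Good t d₀ G C j w → ∀ e ∈ M.carrier d₀ e₀ G w,
        (e ∈ (M.decode t d₀ e₀ G C.write.length hG).ext D w ↔
          e ∈ M.concept w (posName (m + D.write.length))) := by
  have heq {j w} (hw : M.Good t d₀ G C j w) {X Y : LinConcept n}
      (hXY : ∀ S, ∀ Z ∈ equivalence X Y, Z ∈ constraints t S C 0) :
      ∀ e ∈ M.carrier d₀ e₀ G w, (e ∈ M.ext X w ↔ e ∈ M.ext Y w) := by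
    -- Equivalences occur in the constraints for every selection, so any list of the right length
    -- will do.
    have := (M.forall_mem_equivalence (X := X) (Y := Y) hw.mem_dom).1 fun Z hZ =>
      hw.constraints (S := List.replicate C.write.length true) (by simp) (hXY _ Z hZ)
    intro e he
    rw [mem_carrier he₀ hlt hw.1] at he
    exact this e he.1 he.2
  have hdom {w e} (hw : G w) : e ∈ M.carrier d₀ e₀ G w ↔ e ∈ M.dom w ∧ M.lt d₀ e :=
    mem_carrier he₀ hlt hw
  induction D with
  | atom A =>
    intro m hm hsub j w hj hw e he
    refine Iff.trans ?_ (heq hw (fun S X hX => hsub S X hX) e he).symm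
    exact and_iff_right he
  | nominal a =>
    intro m hm hsub j w hj hw e he
    refine Iff.trans ?_ (heq hw (fun S X hX => hsub S X (List.mem_append_left _ hX)) e he).symm
    rw [mem_ext_lastNominal he₀ hlt hw.1 he]
    refine decode_indiv_eq fun ht => ?_
    subst ht
    have := hw.constraints (S := List.replicate C.write.length true) (by simp)
      (hsub _ _ (List.mem_append_right _ (List.mem_singleton_self _)))
    obtain ⟨_, e, he, hlt', hN⟩ := this
    exact exists_isLast ⟨e, (hdom hw.1).2 ⟨he, hlt'⟩, hN⟩
  | neg D ih =>
    intro m hm hsub j w hj hw e he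
    refine Iff.trans ?_ (heq hw (fun S X hX => hsub S X (List.mem_append_left _ hX)) e he).symm
    simp only [Concept.write, List.length_cons] at hm hj
    have := ih m (by omega) (fun S X hX => hsub S X (List.mem_append_right _ hX)) j w (by omega)
      hw e he
    exact and_congr (iff_of_true he ((hdom hw.1).1 he).1) (not_congr this)
  | and D E ihD ihE =>
    intro m hm hsub j w hj hw e he
    refine Iff.trans ?_ (heq hw (fun S X hX => hsub S X (List.mem_append_left _ hX)) e he).symm
    simp only [Concept.write, List.length_cons, List.length_append] at hm hj
    exact and_congr
      (ihD (m + E.write.length) (by omega) (fun S X hX =>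
        hsub S X (List.mem_append_right _ (List.mem_append_left _ hX))) j w (by omega) hw e he)
      (ihE m (by omega) (fun S X hX =>
        hsub S X (List.mem_append_right _ (List.mem_append_right _ hX))) j w (by omega) hw e he)
  | existsRole r D ih =>
    intro m hm hsub j w hj hw e he
    refine Iff.trans ?_ (heq hw (fun S X hX => hsub S X (List.mem_append_left _ hX)) e he).symm
    simp only [Concept.write, List.length_cons, List.length_append] at hm hj
    have ih := ih m (by omega) (fun S X hX =>
      hsub S X (List.mem_append_right _ (List.mem_cons_of_mem _ hX))) j w (by omega) hw
    -- The definition of the decoded roles numbers positions as `i + 1`; no concept is written as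
    -- the empty word, so the position of `D` has this form.
    have hpos : m + D.write.length = m + D.write.length - 1 + 1 := by
      have : D.write ≠ [] := by cases D <;> simp [Concept.write]
      have := List.length_pos_of_ne_nil this
      omega
    constructor
    · rintro ⟨e', ⟨_, he', hr⟩, hD⟩
      have := hr (m + D.write.length - 1) (by omega) (hpos ▸ (ih e' he').1 hD)
      rwa [← hpos] at this
    · intro hr
      have he' := (hdom hw.1).1 he
      obtain ⟨e', h₁, h₂, h₃, h₄⟩ := exists_witness (k := C.write.length) hw.mem_dom (fun S hS =>
        hw.constraints hS (hsub S _ (List.mem_append_right _ List.mem_cons_self))) he'.1 he'.2 hr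
      have hc := (hdom hw.1).2 ⟨h₁, h₂⟩
      exact ⟨e', ⟨he, hc, h₄⟩, (ih e' hc).2 h₃⟩
  | existsUniv D ih =>
    intro m hm hsub j w hj hw e he
    have hS : (List.replicate C.write.length true).length = C.write.length := by simp
    have h₁ := hw.constraints hS (hsub _ _ List.mem_cons_self)
    have h₂ := hw.constraints hS (hsub _ _ (List.mem_cons_of_mem _ List.mem_cons_self))
    simp only [Concept.write, List.length_cons] at hm hj
    have ih := ih m (by omega) (fun S X hX =>
      hsub S X (List.mem_cons_of_mem _ (List.mem_cons_of_mem _ hX))) j w (by omega) hw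
    rw [mem_ext_implication _ hw.mem_dom] at h₁
    have he' := (hdom hw.1).1 he
    constructor
    · rintro ⟨_, e', hc, hD⟩
      by_contra hn
      have hc' := (hdom hw.1).1 hc
      exact h₂.2 ⟨⟨hw.mem_dom, e, he'.1, he'.2, he'.1, hn⟩,
        hw.mem_dom, e', hc'.1, hc'.2, (ih e' hc).1 hD⟩
    · intro h
      obtain ⟨_, e', hd', hlt', hD⟩ := h₁ ⟨hw.mem_dom, e, he'.1, he'.2, h⟩
      have hc := (hdom hw.1).2 ⟨hd', hlt'⟩
      exact ⟨he, e', hc, (ih e' hc).2 hD⟩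
  | dia i D ih =>
    intro m hm hsub j w hj hw e he
    refine Iff.trans ?_ (heq hw (fun S X hX => hsub S X (List.mem_append_left _ hX)) e he).symm
    simp only [Concept.write, List.length_cons] at hm hj
    -- One box is spent on the move to `w'`; the letter for the diamond pays for it.
    obtain ⟨j, rfl⟩ : ∃ j', j = j' + 1 := ⟨j - 1, by omega⟩
    have ih := ih m (by omega) (fun S X hX => hsub S X (List.mem_append_right _ hX)) j
    refine and_congr (iff_of_true he ((hdom hw.1).1 he).1) (exists_congr fun w' =>
      and_congr_right fun hww' => ih w' (by omega) (hw.rel hG hww') e ?_)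
    exact (M.decode t d₀ e₀ G C.write.length hG).dom_mono i w w' hww' he

end LinInterp

theorem Concept.Satisfiable.of_translate {𝒞 : Set (Frame.{u} n)} {k : DomainKind} {t : NameKind}
    {C : Concept n} (h : LinConcept.Satisfiable.{u, v} 𝒞 k (ModalDL.translate t C)) :
    Concept.Satisfiable.{u, v} 𝒞 k t C := by
  obtain ⟨F, hF, M, hk, w₀, d₀, ⟨hd₀, e₀, he₀, hlt, hC⟩, hbox⟩ := h
  -- For constant domains all worlds can be kept, as `e₀` exists everywhere. For expanding domains
  -- the worlds containing `e₀` are kept; they are closed under accessibility and include `w₀`.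
  obtain ⟨G, hG, hGe, hG₀, hGk⟩ : ∃ G : F.World → Prop, (∀ i w w', F.rel i w w' → G w → G w') ∧
      (∀ w, G w → e₀ ∈ M.dom w) ∧ G w₀ ∧ (k = .constant → ∀ w, G w) := by
    cases k with
    | constant =>
      exact ⟨fun _ => True, fun _ _ _ _ => id, fun w _ => hk w₀ w ▸ he₀, trivial,
        fun _ _ => trivial⟩
    | expanding =>
      exact ⟨fun w => e₀ ∈ M.dom w, fun i w w' h h' => M.dom_mono i w w' h h',
        fun _ => id, he₀, fun h => nomatch h⟩
  refine ⟨F, hF, M.decode t d₀ e₀ G C.write.length hG, ?_, LinInterp.decode_admits, w₀, e₀, ?_⟩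
  · cases k with
    | constant =>
      intro w w'
      ext e
      exact or_congr Iff.rfl (and_congr (iff_of_true (hGk rfl w) (hGk rfl w'))
        (and_congr (by rw [hk w w']) Iff.rfl))
    | expanding => trivial
  · refine (LinInterp.mem_decode_ext hGe hlt C 0 (by simp) (fun _ _ => id) C.write.length w₀
      le_rfl ⟨hG₀, hbox⟩ e₀ (Or.inl rfl)).2 ?_
    rwa [Nat.zero_add]

theorem satisfiable_iff_translate (𝒞 : Set (Frame.{u} n)) (k : DomainKind) (t : NameKind)
    (C : Concept n) : Concept.Satisfiable.{u, v} 𝒞 k t C ↔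
      LinConcept.Satisfiable.{u, v} 𝒞 k (translate t C) :=
  ⟨Concept.Satisfiable.translate, Concept.Satisfiable.of_translate⟩

end ModalDL

/-! ### Combinators for stack programs and their running times -/

namespace StackProgram

open Function

namespace Prog

variable {K Γ : Type}

/-- Run the programs in a list one after the other. -/
def block (l : List (Prog K Γ)) : Prog K Γ := l.foldr seq nop

/-- Run the programs in a list one after the other, the last one first. -/
def revBlock : List (Prog K Γ) → Prog K Γ
  | [] => nop
  | p :: l => seq (revBlock l) p

/-- Push a word onto a stack, the last letter first. -/
def pushAll (k : K) (w : List Γ) : Prog K Γ := revBlock (w.map (push k))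

/-- Pop all letters of a stack and run the body on them. -/
def forEach (k : K) (f : Γ → Prog K Γ) : Prog K Γ := loop k (fun _ => true) f

/-- Empty a stack. -/
def clear (k : K) : Prog K Γ := forEach k fun _ => nop

/-- Move all letters of the stack `x` to the stack `y`. -/
def moveAll (x y : K) : Prog K Γ := forEach x (push y)

/-- Push the content of the stack `x` onto the stack `y`, with the help of the stack `z`. -/
def copy (x y z : K) : Prog K Γ :=
  seq (moveAll x z) (forEach z fun a => seq (push x a) (push y a))

variable [DecidableEq K] {s s' s₁ s₂ : K → List Γ} {t t₁ t₂ : ℕ} {p : Prog K Γ}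

/-- One unit of time pushes at most one letter. Time bounds therefore bound the size of intermediate
outputs as well. -/
theorem Runs.length_le (h : Runs p s s' t) (k : K) : (s' k).length ≤ (s k).length + t := by
  induction h with
  | nop s => omega
  | push k' a s =>
    by_cases hk : k = k'
    · subst hk; simp
    · simp [hk]
  | seq _ _ h₁ h₂ => omega
  | @popCase k' f s s' t _ h =>
    refine h.trans ?_
    by_cases hk : k = k'
    · subst hk
      simp only [update_self, List.length_tail]
      omega
    · simp [hk]
  | loop_exit _ => omega
  | @loop_step k' c f s a l s₁ s₂ t₁ t₂ hs _ _ _ h₁ h₂ =>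
    have : (update s k' l k).length ≤ (s k).length := by
      by_cases hk : k = k'
      · subst hk; simp [hs]
      · simp [hk]
    omega
  | mono _ h h' => omega

theorem Runs.block_nil : Runs (block []) s s 1 := .nop s

theorem Runs.block_cons {l : List (Prog K Γ)} (h₁ : Runs p s s₁ t₁)
    (h₂ : Runs (block l) s₁ s₂ t₂) : Runs (block (p :: l)) s s₂ (t₁ + t₂) := .seq h₁ h₂

theorem Runs.of_eq (h : Runs p s s₁ t) (hs : s₁ = s₂) : Runs p s s₂ t := hs ▸ h

theorem Runs.convert (h : Runs p s s₁ t) (ht : t ≤ t₁) (hs : s₁ = s₂) : Runs p s s₂ t₁ :=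
  hs ▸ h.mono ht

theorem Runs.push' {k : K} {a : Γ} (hs : update s k (a :: s k) = s') :
    Runs (Prog.push k a) s s' 1 := hs ▸ .push k a s

theorem Runs.forEach_nil {k : K} {f : Γ → Prog K Γ} (h : s k = []) : Runs (forEach k f) s s 1 :=
  .loop_exit (by simp [h])

theorem Runs.forEach_cons {k : K} {f : Γ → Prog K Γ} {a : Γ} {l : List Γ} (h : s k = a :: l)
    (h₁ : Runs (f a) (update s k l) s₁ t₁) (h₂ : Runs (forEach k f) s₁ s₂ t₂) :
    Runs (forEach k f) s s₂ (t₁ + t₂ + 1) :=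
  .loop_step h rfl h₁ h₂

theorem Runs.clear {k : K} {w : List Γ} (hw : s k = w) :
    Runs (clear k) s (update s k []) (2 * w.length + 1) := by
  induction w generalizing s with
  | nil =>
    refine (Runs.forEach_nil hw).of_eq ?_
    rw [← hw, update_eq_self]
  | cons a l ih =>
    refine ((Runs.forEach_cons hw (.nop _) (ih (update_self _ _ _))).mono ?_).of_eq ?_
    · simp; omega
    · simp

theorem Runs.moveAll {x y : K} (hxy : x ≠ y) {w : List Γ} (hw : s x = w) :
    Runs (moveAll x y) s (update (update s x []) y (w.reverse ++ s y)) (2 * w.length + 1) := by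
  induction w generalizing s with
  | nil =>
    refine ((Runs.forEach_nil hw).mono (by simp)).of_eq ?_
    have : update s x [] = s := by rw [← hw, update_eq_self]
    simp [this]
  | cons a l ih =>
    refine ((Runs.forEach_cons hw (.push _ _ _) (ih ?_)).mono ?_).of_eq ?_
    · simp [hxy]
    · simp; omega
    · funext r
      by_cases hy : r = y
      · subst hy; simp [hxy.symm]
      · by_cases hx : r = x
        · subst hx; simp [hxy]
        · simp [hx, hy]

theorem Runs.copy {x y z : K} (hxy : x ≠ y) (hxz : x ≠ z) (hyz : y ≠ z) (hz : s z = []) :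
    Runs (copy x y z) s (update s y (s x ++ s y)) (5 * (s x).length + 2) := by
  have h (l : List Γ) : ∀ s : K → List Γ, s z = l →
      Runs (Prog.forEach z fun a => Prog.seq (Prog.push x a) (Prog.push y a)) s
        (update (update (update s z []) x (l.reverse ++ s x)) y (l.reverse ++ s y))
        (3 * l.length + 1) := by
    induction l with
    | nil =>
      intro s hs
      refine ((Runs.forEach_nil hs).mono (by simp)).of_eq ?_
      have : update s z [] = s := by rw [← hs, update_eq_self]
      simp [this]
    | cons a l ih =>
      intro s hs
      refine ((Runs.forEach_cons hs (.seq (.push _ _ _) (.push _ _ _)) (ih _ ?_)).mono ?_).of_eq ?_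
      · simp [hxz.symm, hyz.symm]
      · simp; omega
      · funext r
        by_cases hy : r = y
        · subst hy; simp [hxy.symm, hyz]
        · by_cases hx : r = x
          · subst hx; simp [hy, hxz]
          · by_cases hr : r = z
            · subst hr; simp [hy, hx]
            · simp [hx, hy, hr]
  refine ((Runs.seq (Runs.moveAll hxz rfl) (h _ _ (update_self _ _ _))).mono ?_).of_eq ?_
  · simp [hz]; omega
  · funext r
    by_cases hy : r = y
    · subst hy; simp [hxy.symm, hyz, hz]
    · by_cases hx : r = x
      · subst hx; simp [hy, hxz, hz]
      · by_cases hr : r = z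
        · subst hr; simp [hy, hx, hz]
        · simp [hx, hy, hr]

/-- The program `p`, when run on stacks that agree with `s` except for `o`, pushes the word `w` onto
the stack `o` and changes nothing else. -/
def Emits (o : K) (p : Prog K Γ) (s : K → List Γ) (w : List Γ) (t : ℕ) : Prop :=
  ∀ l, Runs p (update s o l) (update s o (w ++ l)) t

variable {o : K} {w w₁ w₂ : List Γ}

theorem Emits.mono (h : Emits o p s w t) (ht : t ≤ t₁) : Emits o p s w t₁ :=
  fun l => (h l).mono ht

theorem Emits.revBlock_nil : Emits o (revBlock []) s [] 1 := fun _ => .nop _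

/-- A stack grows at its front, so the program for the first part of the word has to run last. -/
theorem Emits.revBlock_cons {l : List (Prog K Γ)} (h₁ : Emits o p s w₁ t₁)
    (h₂ : Emits o (revBlock l) s w₂ t₂) : Emits o (revBlock (p :: l)) s (w₁ ++ w₂) (t₁ + t₂) := by
  intro l
  have := Runs.seq (h₂ l) (h₁ _)
  rw [List.append_assoc, Nat.add_comm]
  exact this

theorem Emits.push {a : Γ} : Emits o (Prog.push o a) s [a] 1 :=
  fun _ => .push' (by simp)

theorem Emits.pushAll {w : List Γ} : Emits o (pushAll o w) s w (w.length + 1) := by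
  induction w with
  | nil => exact Emits.revBlock_nil
  | cons a w ih =>
    have := Emits.revBlock_cons (Emits.push (a := a)) ih
    rw [Nat.add_comm] at this
    exact this

theorem Emits.copy {x z : K} (hxo : x ≠ o) (hxz : x ≠ z) (hoz : o ≠ z) (hz : s z = []) :
    Emits o (copy x o z) s (s x) (5 * (s x).length + 2) := by
  intro l
  have := Runs.copy (s := update s o l) hxo hxz hoz (by simpa [hoz.symm] using hz)
  simpa [hxo] using this

theorem Emits.runs (h : Emits o p s w t) : Runs p s (update s o (w ++ s o)) t := by
  have := h (s o)
  rwa [update_eq_self] at this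

end Prog

end StackProgram

/-! ### Programs that write concepts and constraints -/

namespace ModalDL

open StackProgram StackProgram.Prog LinConcept Function

variable {n : ℕ}

/-- The stacks of the translating machine. -/
inductive Reg : Type
  | input
  | word
  | seen
  | sel
  | sel'
  | count
  | flag
  | cur
  | results
  | name
  | fst
  | snd
  | idx
  | tmp
  | out
  deriving DecidableEq

instance : Fintype Reg where
  elems := {.input, .word, .seen, .sel, .sel', .count, .flag, .cur, .results, .name, .fst, .snd,
    .idx, .tmp, .out}
  complete r := by cases r <;> simp

/-- A number in unary notation. -/
def ones (q : ℕ) : List (Letter n) := List.replicate q (.bit true)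

theorem map_replicate_true (q : ℕ) :
    (List.replicate q true).map (Letter.bit (n := n)) = ones q := by
  simp [ones]

/-- Programs of the translating machine. -/
abbrev Program (n : ℕ) : Type := Prog Reg (Letter n)

/-- A program that writes a concept in front of the output. -/
abbrev Writes (p : Program n) (s : Reg → List (Letter n)) (X : LinConcept n) (t : ℕ) : Prop :=
  Emits .out p s X.write t

/-- A program that writes conjuncts in front of the output. -/
def WritesAll (p : Program n) (s : Reg → List (Letter n)) (L : List (LinConcept n)) (t : ℕ) :
    Prop :=
  ∀ B l, Runs p (update s .out (B.write ++ l)) (update s .out ((conjoin L B).write ++ l)) t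

/-! ### Writing concepts -/

def writeNeg (p : Program n) : Program n := revBlock [push .out .neg, p]

def writeAnd (p q : Program n) : Program n := revBlock [push .out .and, p, q]

def writeExistsOrd (p : Program n) : Program n := revBlock [push .out .existsOrd, p]

def writeDia (i : Fin n) (p : Program n) : Program n := revBlock [push .out (.dia i), p]

def writeInclusion (p q : Program n) : Program n :=
  writeNeg (writeExistsOrd (writeAnd p (writeNeg q)))

/-- Write an atom with the position on the stack `x`. -/
def writePos (x : Reg) : Program n :=
  revBlock [pushAll .out [.concept, .bit false, .bit false], copy x .out .tmp, push .out .endMark]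

/-- Write an atom with the position on the stack `x` and the current role name. -/
def writeRole (x : Reg) : Program n :=
  revBlock [pushAll .out [.concept, .bit false, .bit true], copy x .out .tmp,
    push .out (.bit false), copy .name .out .tmp, push .out .endMark]

/-- Write an atom that consists of two bits and the current name. -/
def writeNamed (b c : Bool) : Program n :=
  revBlock [pushAll .out [.concept, .bit b, .bit c], copy .name .out .tmp, push .out .endMark]

def writeLastNominal : Program n :=
  writeAnd (writeNamed true true) (writeNeg (writeExistsOrd (writeNamed true true)))

/-- Write a conjunct. -/
def writeConjunct (p : Program n) : Program n := revBlock [push .out .and, p]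

def writeEquivalence (p q : Program n) : Program n :=
  revBlock [writeConjunct (writeInclusion p q), writeConjunct (writeInclusion q p)]

/-- Write negated conjuncts for the positions selected by the stack `sel`. -/
def writeNegConj (p q : Program n) : Program n :=
  -- The base conjunct is written first, since later conjuncts are put in front of it. The selection
  -- is saved on `sel'` and moved back at the end because it is needed again.
  block [q,
    forEach .sel fun a => block [push .sel' a, push .idx (.bit true),
      match a with
      | .bit true => revBlock [push .out .and, writeNeg p]
      | _ => nop],
    moveAll .sel' .sel, clear .idx]

def writeWitnessConstraint (x : Reg) : Program n :=
  writeNeg (writeAnd (writeExistsOrd (writeNegConj (writeRole .idx) (writeRole x)))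
    (writeNeg (writeExistsOrd (writeNegConj (writePos .idx) (writePos x)))))

section

variable {s : Reg → List (Letter n)} {p q : Program n} {X Y : LinConcept n} {t t' k : ℕ}

theorem Writes.neg (h : Writes p s X t) : Writes (writeNeg p) s X.neg (t + 2) := by
  have := Emits.revBlock_cons (.push (a := .neg)) (.revBlock_cons h .revBlock_nil)
  rw [List.append_nil] at this
  exact this.mono (by omega)

theorem Writes.existsOrd (h : Writes p s X t) : Writes (writeExistsOrd p) s X.existsOrd (t + 2) := by
  have := Emits.revBlock_cons (.push (a := .existsOrd)) (.revBlock_cons h .revBlock_nil)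
  rw [List.append_nil] at this
  exact this.mono (by omega)

theorem Writes.dia {i : Fin n} (h : Writes p s X t) : Writes (writeDia i p) s (X.dia i) (t + 2) := by
  have := Emits.revBlock_cons (.push (a := .dia i)) (.revBlock_cons h .revBlock_nil)
  rw [List.append_nil] at this
  exact this.mono (by omega)

theorem Writes.and (h : Writes p s X t) (h' : Writes q s Y t') :
    Writes (writeAnd p q) s (X.and Y) (t + t' + 2) := by
  have := Emits.revBlock_cons (.push (a := .and)) (.revBlock_cons h (.revBlock_cons h' .revBlock_nil))
  rw [List.append_nil] at this
  exact this.mono (by omega)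

theorem Writes.inclusion (h : Writes p s X t) (h' : Writes q s Y t') :
    Writes (writeInclusion p q) s (inclusion X Y) (t + t' + 8) :=
  (h.and h'.neg).existsOrd.neg.mono (by omega)

theorem WritesAll.of_writes (h : Writes p s X t) : WritesAll (writeConjunct p) s [X] (t + 2) := by
  intro B l
  have := Emits.revBlock_cons (.push (a := .and)) (.revBlock_cons h .revBlock_nil) (B.write ++ l)
  refine (this.mono (by omega)).of_eq ?_
  simp [conjoin, LinConcept.write]

theorem WritesAll.nil : WritesAll (revBlock []) s [] 1 := fun _ _ => .nop _

theorem WritesAll.cons {l : List (Program n)} {L L' : List (LinConcept n)}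
    (h : WritesAll p s L t) (h' : WritesAll (revBlock l) s L' t') :
    WritesAll (revBlock (p :: l)) s (L ++ L') (t + t') := by
  intro B l
  have := Runs.seq (h' B l) (h _ l)
  rw [Nat.add_comm] at this
  refine this.of_eq ?_
  simp [conjoin]

theorem WritesAll.mono {L : List (LinConcept n)} (h : WritesAll p s L t) (ht : t ≤ t') :
    WritesAll p s L t' := fun B l => (h B l).mono ht

theorem WritesAll.equivalence (h : Writes p s X t) (h' : Writes q s Y t') :
    WritesAll (writeEquivalence p q) s (equivalence X Y) (2 * t + 2 * t' + 21) :=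
  (WritesAll.cons (.of_writes (h.inclusion h'))
    (.cons (.of_writes (h'.inclusion h)) .nil)).mono (by omega)

theorem writes_writePos {x : Reg} {m : ℕ} (hx : s x = ones m) (hxo : x ≠ .out) (hxt : x ≠ .tmp)
    (ht : s .tmp = []) (hm : m ≤ k) : Writes (writePos x) s (posAtom m) (5 * k + 8) := by
  have := Emits.revBlock_cons (Emits.pushAll (s := s) (o := Reg.out)
      (w := [.concept, .bit false, .bit false]))
    (.revBlock_cons (.copy hxo hxt (by decide) ht) (.revBlock_cons (.push (a := .endMark)) .revBlock_nil))
  rw [hx] at this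
  have hw : (posAtom m : LinConcept n).write =
      [.concept, .bit false, .bit false] ++ (ones m ++ ([.endMark] ++ [])) := by
    simp [posAtom, LinConcept.write, posName, writeName, ones]
  rw [← hw] at this
  refine this.mono ?_
  simp [ones]
  omega

theorem writes_writeRole {x : Reg} {m : ℕ} {r : Name} (hx : s x = ones m) (hxo : x ≠ .out)
    (hxt : x ≠ .tmp) (hr : s .name = r.map .bit) (ht : s .tmp = []) (hm : m ≤ k)
    (hrk : r.length ≤ k) : Writes (writeRole x) s (roleAtom r m) (10 * k + 11) := by
  have := Emits.revBlock_cons (Emits.pushAll (s := s) (o := Reg.out)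
      (w := [.concept, .bit false, .bit true]))
    (.revBlock_cons (.copy hxo hxt (by decide) ht) (.revBlock_cons (.push (a := .bit false))
      (.revBlock_cons (.copy (x := .name) (by decide) (by decide) (by decide) ht)
        (.revBlock_cons (.push (a := .endMark)) .revBlock_nil))))
  rw [hx, hr] at this
  have hw : (roleAtom r m : LinConcept n).write = [.concept, .bit false, .bit true] ++
      (ones m ++ ([.bit false] ++ (r.map .bit ++ ([.endMark] ++ [])))) := by
    simp [roleAtom, LinConcept.write, roleName, writeName, ones]
  rw [← hw] at this
  refine this.mono ?_
  simp [ones]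
  omega

theorem writes_writeNamed {r : Name} (b c : Bool) (hr : s .name = r.map .bit) (ht : s .tmp = [])
    (hrk : r.length ≤ k) :
    Writes (writeNamed b c) s (.atom (b :: c :: r)) (5 * k + 8) := by
  have := Emits.revBlock_cons (Emits.pushAll (s := s) (o := Reg.out)
      (w := [.concept, .bit b, .bit c]))
    (.revBlock_cons (.copy (x := .name) (by decide) (by decide) (by decide) ht)
      (.revBlock_cons (.push (a := .endMark)) .revBlock_nil))
  rw [hr] at this
  have hw : (LinConcept.atom (b :: c :: r) : LinConcept n).write =
      [.concept, .bit b, .bit c] ++ (r.map .bit ++ ([.endMark] ++ [])) := by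
    simp [LinConcept.write, writeName]
  rw [← hw] at this
  refine this.mono ?_
  simp
  omega

theorem writes_writeLastNominal {a : Name} (ha : s .name = a.map .bit) (ht : s .tmp = [])
    (hak : a.length ≤ k) : Writes writeLastNominal s (lastNominal a) (10 * k + 22) :=
  have h := writes_writeNamed true true ha ht hak
  Emits.mono (Writes.and h (Writes.neg (Writes.existsOrd h))) (by omega)

/-- Loop invariant: the digits already read lie reversed on `sel'`, `idx` holds their number in
unary, and the output starts with the conjunction built so far. The writer `p` need only work for
indices up to `m`, which allows one time bound `t` for all rounds. -/
theorem runs_negConj_loop {X : ℕ → LinConcept n} {m : ℕ} (h : ∀ i S S', i ≤ m →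
      Writes p (update (update (update s .sel S) .sel' S') .idx (ones i)) (X i) t)
    (S : List Bool) : ∀ (c : ℕ) (S' l : List (Letter n)) (B : LinConcept n), c + S.length ≤ m →
      Runs (forEach .sel fun a => block [push .sel' a, push .idx (.bit true),
        match a with
        | .bit true => revBlock [push .out .and, writeNeg p]
        | _ => nop])
      (update (update (update (update s .sel (S.map .bit)) .sel' S') .idx (ones c)) .out
        (B.write ++ l))
      (update (update (update (update s .sel []) .sel' ((S.map .bit).reverse ++ S')) .idx
        (ones (c + S.length))) .out ((negConj X S c B).write ++ l))
      (S.length * (t + 8) + 1) := by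
  induction S with
  | nil =>
    intro c S' l B _
    exact (Runs.forEach_nil (by simp)).mono (by simp)
  | cons b S ih =>
    intro c S' l B hm
    simp only [List.length_cons] at hm ⊢
    have hc : update (update (update (update (update (update (update s .sel ((b :: S).map .bit))
          .sel' S') .idx (ones c)) .out (B.write ++ l)) .sel (S.map .bit)) .sel' (.bit b :: S'))
          .idx (ones (c + 1)) = update (update (update (update s .sel (S.map .bit))
            .sel' (.bit b :: S')) .idx (ones (c + 1))) .out (B.write ++ l) := by
      funext r
      cases r <;> simp
    have h₁ : Runs (match (.bit b : Letter n) with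
        | .bit true => revBlock [push .out .and, writeNeg p]
        | _ => nop)
        (update (update (update (update s .sel (S.map .bit)) .sel' (.bit b :: S')) .idx
          (ones (c + 1))) .out (B.write ++ l))
        (update (update (update (update s .sel (S.map .bit)) .sel' (.bit b :: S')) .idx
          (ones (c + 1))) .out
            ((if b then LinConcept.and (.neg (X (c + 1))) B else B).write ++ l)) (t + 4) := by
      cases b with
      | false => exact (Runs.nop _).mono (by omega)
      | true =>
        have := Emits.revBlock_cons (.push (a := .and)) (.revBlock_cons
          (Writes.neg (h (c + 1) (S.map .bit) (.bit true :: S') (by omega))) .revBlock_nil)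
          (B.write ++ l)
        refine (this.mono (by omega)).of_eq ?_
        simp [LinConcept.write]
    refine ((Runs.forEach_cons (a := .bit b) (l := S.map .bit) (by simp)
      (.block_cons (.push _ _ _) (.block_cons (.push' (s' := _) ?_) (.block_cons h₁ .block_nil)))
      (ih (c + 1) (.bit b :: S') l _ (by omega))).mono ?_).of_eq ?_
    · rw [← hc]
      funext r
      cases r <;> simp [ones, List.replicate_succ]
    · rw [Nat.succ_mul]
      omega
    · rw [negConj, show c + 1 + S.length = c + (S.length + 1) by omega]
      simp

theorem writes_writeNegConj {X : ℕ → LinConcept n} {S : List Bool} (hS : s .sel = S.map .bit)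
    (hS' : s .sel' = []) (hi : s .idx = []) (hSk : S.length = k)
    (h : ∀ i S S', i ≤ k →
      Writes p (update (update (update s .sel S) .sel' S') .idx (ones i)) (X i) t)
    (hq : Writes q s Y t') :
    Writes (writeNegConj p q) s (negConj X S 0 Y) (k * (t + 12) + t' + 4) := by
  intro l
  have h₀ : update (update (update (update s .sel (S.map .bit)) .sel' []) .idx (ones 0)) .out
      (Y.write ++ l) = update s .out (Y.write ++ l) := by
    rw [← hS, ← hS', show ones 0 = s .idx from hi.symm]
    simp
  have h₁ := runs_negConj_loop h S 0 [] l Y (by omega)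
  rw [h₀] at h₁
  refine ((Runs.block_cons (hq l) (.block_cons h₁ (.block_cons (.moveAll (by decide) rfl)
    (.block_cons (.clear rfl) .block_nil)))).mono ?_).of_eq ?_
  · simp [ones, hSk, Nat.mul_add]
    omega
  · funext r
    cases r <;> simp [hS, hS', hi]

theorem writes_writeWitnessConstraint {x : Reg} {S : List Bool} {r : Name} {m : ℕ}
    (hS : s .sel = S.map .bit) (hS' : s .sel' = []) (hi : s .idx = []) (hSk : S.length = k)
    (hx : s x = ones m) (hxo : x ≠ .out) (hxt : x ≠ .tmp) (hr : s .name = r.map .bit)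
    (ht : s .tmp = []) (hm : m ≤ k) (hrk : r.length ≤ k) :
    Writes (writeWitnessConstraint x) s (witnessConstraint S r m)
      (k * (15 * k + 43) + 15 * k + 37) := by
  have h₁ := writes_writeNegConj (p := writeRole .idx) (X := roleAtom r) hS hS' hi hSk
    (fun i S S' hi => writes_writeRole (r := r) (by simp) (by decide) (by decide) (by simp [hr])
      (by simp [ht]) hi hrk) (writes_writeRole hx hxo hxt hr ht hm hrk)
  have h₂ := writes_writeNegConj (p := writePos .idx) (X := posAtom) hS hS' hi hSk
    (fun i S S' hi => writes_writePos (by simp) (by decide) (by decide) (by simp [ht]) hi)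
    (writes_writePos hx hxo hxt ht hm)
  refine Emits.mono (Writes.neg (Writes.and (Writes.existsOrd h₁)
    (Writes.neg (Writes.existsOrd h₂)))) ?_
  ring_nf
  omega

end

end ModalDL

namespace ModalDL

open StackProgram StackProgram.Prog LinConcept Function

variable {n : ℕ}

/-! ### Scanning the input -/

/-- A stack of numbers in unary notation. -/
def numbers (ns : List ℕ) : List (Letter n) := ns.flatMap fun q => ones q ++ [.bit false]

/-- The contents of the contents while the input is scanned. -/
def contents (w v : List (Letter n)) (S : List Bool) (c : List (Letter n)) (m : ℕ) (ns : List ℕ)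
    (r : Name) (a b : ℕ) (o : List (Letter n)) : Reg → List (Letter n)
  | .word => w
  | .seen => v
  | .sel => S.map .bit
  | .count => c
  | .cur => ones m
  | .results => numbers ns
  | .name => r.map .bit
  | .fst => ones a
  | .snd => ones b
  | .out => o
  | _ => []

def isOne : Letter n → Bool
  | .bit b => b
  | _ => false

/-- Move a number from the stack of results to the stack `x`. -/
def popNumber (x : Reg) : Program n :=
  seq (loop .results isOne fun _ => push x (.bit true)) (popCase .results fun _ => nop)

/-- Push the current position onto the stack of results and reset the other stacks. -/
def finishConcept : Program n :=
  block [clear .fst, clear .snd, clear .name, push .results (.bit false),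
    copy .cur .results .tmp]

def writeNameConstraint : NameKind → Program n
  | .total => writeConjunct (writeExistsOrd (writeNamed true true))
  | .partially => nop

/-- Process a letter of the input, read from the right. -/
def processLetter (t : NameKind) : Letter n → Program n
  | .bit b => push .name (.bit b)
  | .endMark => nop
  | .existsOrd => nop
  | .concept => block [writeEquivalence (writePos .cur) (writeNamed true false), finishConcept]
  | .nominal => block [revBlock [writeEquivalence (writePos .cur) writeLastNominal,
      writeNameConstraint t], finishConcept]
  | .neg => block [popNumber .fst,
      writeEquivalence (writePos .cur) (writeNeg (writePos .fst)), finishConcept]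
  | .and => block [popNumber .fst, popNumber .snd,
      writeEquivalence (writePos .cur) (writeAnd (writePos .fst) (writePos .snd)), finishConcept]
  | .existsRole => block [popNumber .fst,
      revBlock [writeEquivalence (writePos .cur) (writeRole .fst),
        writeConjunct (writeWitnessConstraint .fst)], finishConcept]
  | .existsUniv => block [popNumber .fst,
      revBlock [writeConjunct (writeNeg (writeAnd (writeExistsOrd (writePos .cur))
          (writeNeg (writeExistsOrd (writePos .fst))))),
        writeConjunct (writeNeg (writeAnd (writeExistsOrd (writeNeg (writePos .cur)))
          (writeExistsOrd (writePos .fst))))], finishConcept]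
  | .dia i => block [popNumber .fst,
      writeEquivalence (writePos .cur) (writeDia i (writePos .fst)), finishConcept]

/-- Process the stack `word`. -/
def scan (t : NameKind) : Program n :=
  forEach .word fun a => block [push .seen a, push .cur (.bit true), processLetter t a]

/-- Numbers on the stack of results are blocks of ones closed by a `false`: the loop moves the ones
and `popCase` removes the terminator. -/
theorem runs_popNumber_aux {x : Reg} (hx : x ≠ .results) (R : List (Letter n)) (q : ℕ) :
    ∀ s : Reg → List (Letter n), s .results = ones q ++ .bit false :: R →
      Runs (popNumber x) s (update (update s x (ones q ++ s x)) .results R) (2 * q + 3) := by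
  have h (q : ℕ) : ∀ s : Reg → List (Letter n), s .results = ones q ++ .bit false :: R →
      Runs (loop .results isOne fun _ => push x (.bit true)) s
        (update (update s x (ones q ++ s x)) .results (.bit false :: R)) (2 * q + 1) := by
    induction q with
    | zero =>
      intro s hs
      have hs : s .results = .bit false :: R := hs
      refine (Runs.loop_exit (by simp [hs, isOne])).of_eq ?_
      simp [ones, ← hs]
    | succ q ih =>
      intro s hs
      refine ((Runs.loop_step (f := fun _ => push x (.bit true)) (a := .bit true)
        (l := ones q ++ .bit false :: R) ?_ rfl
        (.push _ _ _) (ih _ ?_)).mono ?_).of_eq ?_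
      · simpa [ones, List.replicate_succ] using hs
      · simp [hx.symm]
      · omega
      · funext r
        by_cases hr : r = .results
        · subst hr; simp
        · by_cases hr' : r = x
          · subst hr'
            simp [hr, ones, List.replicate_succ' (n := q)]
          · simp [hr, hr']
  intro s hs
  refine ((Runs.seq (h q s hs) (.popCase (.nop _))).mono (by omega)).of_eq ?_
  simp

section

variable {w v c o : List (Letter n)} {S : List Bool} {m a b q k T : ℕ} {ns : List ℕ} {r : Name}
  {p : Program n} {t : NameKind}

theorem update_contents_out {o' : List (Letter n)} :
    update (contents w v S c m ns r a b o) .out o' = contents w v S c m ns r a b o' := by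
  funext x
  cases x <;> rfl

theorem WritesAll.runs {L : List (LinConcept n)} {X : LinConcept n}
    (h : WritesAll p (contents w v S c m ns r a b []) L T) :
    Runs p (contents w v S c m ns r a b X.write) (contents w v S c m ns r a b (conjoin L X).write) T := by
  have := h X []
  simpa only [update_contents_out, List.append_nil] using this

theorem runs_popNumber_fst (hq : q ≤ k) : Runs (popNumber .fst)
    (contents w v S c m (q :: ns) r 0 b o) (contents w v S c m ns r q b o) (2 * k + 3) := by
  refine ((runs_popNumber_aux (by decide) (numbers ns) q _ ?_).mono (by omega)).of_eq ?_
  · simp [contents, numbers]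
  · funext x
    cases x <;> simp [contents, ones]

theorem runs_popNumber_snd (hq : q ≤ k) : Runs (popNumber .snd)
    (contents w v S c m (q :: ns) r a 0 o) (contents w v S c m ns r a q o) (2 * k + 3) := by
  refine ((runs_popNumber_aux (by decide) (numbers ns) q _ ?_).mono (by omega)).of_eq ?_
  · simp [contents, numbers]
  · funext x
    cases x <;> simp [contents, ones]

theorem runs_finishConcept (hm : m ≤ k) (ha : a ≤ k) (hb : b ≤ k) (hr : r.length ≤ k) :
    Runs finishConcept (contents w v S c m ns r a b o) (contents w v S c m (m :: ns) [] 0 0 o)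
      (11 * k + 7) := by
  refine ((Runs.block_cons (.clear rfl) (.block_cons (.clear rfl) (.block_cons (.clear rfl)
    (.block_cons (.push _ _ _) (.block_cons (.copy (by decide) (by decide) (by decide) rfl)
      .block_nil))))).mono ?_).of_eq ?_
  · simp [contents, ones]
    omega
  · funext x
    cases x <;> simp [contents, ones, numbers]

/-- Every run of the scanning loop from `s'` gives one from `s` that takes `T` steps more. -/
def ScansTo (t : NameKind) (s s' : Reg → List (Letter n)) (T : ℕ) : Prop :=
  ∀ s'' T', Runs (scan t) s' s'' T' → Runs (scan t) s s'' (T + T')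

theorem ScansTo.trans {s s₁ s₂ : Reg → List (Letter n)} {T₁ T₂ : ℕ} (h₁ : ScansTo t s s₁ T₁)
    (h₂ : ScansTo t s₁ s₂ T₂) : ScansTo t s s₂ (T₁ + T₂) :=
  fun _ _ h => (h₁ _ _ (h₂ _ _ h)).mono (by omega)

theorem ScansTo.mono {s s₁ : Reg → List (Letter n)} {T₁ T₂ : ℕ} (h : ScansTo t s s₁ T₁)
    (hT : T₁ ≤ T₂) : ScansTo t s s₁ T₂ :=
  fun _ _ h' => (h _ _ h').mono (by omega)

theorem ScansTo.letter {x : Letter n} {s' : Reg → List (Letter n)}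
    (h : Runs (processLetter t x) (contents w (x :: v) S c (m + 1) ns r 0 0 o) s' T) :
    ScansTo t (contents (x :: w) v S c m ns r 0 0 o) s' (T + 4) := by
  intro s'' T' h'
  have h₀ : update (update (update (contents (x :: w) v S c m ns r 0 0 o) .word w) .seen (x :: v))
      .cur (ones (m + 1)) = contents w (x :: v) S c (m + 1) ns r 0 0 o := by
    funext x
    cases x <;> rfl
  rw [← h₀] at h
  unfold scan at h' ⊢
  refine Runs.mono (Runs.forEach_cons rfl (.block_cons (.push _ _ _) (.block_cons (.push _ _ _)
    (.block_cons h .block_nil))) h') ?_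
  omega

/-- Read from the right, a name shows its end marker first and its bits in reverse; pushing them
restores the order on the stack `name`. -/
theorem scansTo_writeName (A : Name) :
    ScansTo t (contents ((writeName A).reverse ++ w) v S c m ns [] 0 0 o)
      (contents w (writeName A ++ v) S c (m + (writeName (n := n) A).length) ns A 0 0 o)
      (5 * (writeName (n := n) A).length) := by
  induction A generalizing w with
  | nil => exact ScansTo.letter (.nop _)
  | cons a A ih =>
    have h := ScansTo.letter (t := t) (w := w) (v := writeName A ++ v) (x := .bit a) (S := S)
      (c := c) (m := m + (writeName (n := n) A).length) (ns := ns) (r := A) (o := o) (.push _ _ _)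
    have := (ih (w := .bit a :: w)).trans h
    have hw : (writeName (n := n) (a :: A)).reverse ++ w =
        (writeName A).reverse ++ .bit a :: w := by
      simp [writeName]
    have hs : update (contents w (.bit a :: (writeName A ++ v)) S c
        (m + (writeName (n := n) A).length + 1) ns A 0 0 o) .name (.bit a :: A.map .bit) =
        contents w (writeName (a :: A) ++ v) S c (m + (writeName (n := n) (a :: A)).length) ns
          (a :: A) 0 0 o := by
      funext x
      cases x <;> rfl
    rw [hw, ← hs]
    refine this.mono ?_
    simp [writeName]
    omega

/-- A bound for the time that is needed to process a letter. -/
def letterTime (k : ℕ) : ℕ := 15 * k * k + 120 * k + 200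

theorem conjoin_append (L L' : List (LinConcept n)) (X : LinConcept n) :
    conjoin (L ++ L') X = conjoin L (conjoin L' X) := List.foldr_append

theorem ScansTo.leaf {x : Letter n} {X : LinConcept n} {L : List (LinConcept n)}
    (hx : processLetter t x = block [p, finishConcept])
    (h : WritesAll p (contents w (x :: v) S c (m + 1) ns r 0 0 []) L T)
    (hT : T ≤ 15 * k * k + 100 * k + 150) (hm : m + 1 ≤ k) (hr : r.length ≤ k) :
    ScansTo t (contents (x :: w) v S c m ns r 0 0 X.write)
      (contents w (x :: v) S c (m + 1) ((m + 1) :: ns) [] 0 0 (conjoin L X).write)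
      (letterTime k) := by
  refine (ScansTo.letter (hx ▸ Runs.block_cons h.runs (.block_cons (runs_finishConcept hm
    (Nat.zero_le _) (Nat.zero_le _) hr) .block_nil))).mono ?_
  simp only [letterTime]
  omega

theorem ScansTo.unary {x : Letter n} {X : LinConcept n} {L : List (LinConcept n)}
    (hx : processLetter t x = block [popNumber .fst, p, finishConcept])
    (h : WritesAll p (contents w (x :: v) S c (m + 1) ns r a 0 []) L T)
    (hT : T ≤ 15 * k * k + 100 * k + 150) (hm : m + 1 ≤ k) (ha : a ≤ k) (hr : r.length ≤ k) :
    ScansTo t (contents (x :: w) v S c m (a :: ns) r 0 0 X.write)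
      (contents w (x :: v) S c (m + 1) ((m + 1) :: ns) [] 0 0 (conjoin L X).write)
      (letterTime k) := by
  refine (ScansTo.letter (hx ▸ Runs.block_cons (runs_popNumber_fst ha) (.block_cons h.runs
    (.block_cons (runs_finishConcept hm ha (Nat.zero_le _) hr) .block_nil)))).mono ?_
  simp only [letterTime]
  omega

theorem ScansTo.binary {x : Letter n} {X : LinConcept n} {L : List (LinConcept n)}
    (hx : processLetter t x = block [popNumber .fst, popNumber .snd, p, finishConcept])
    (h : WritesAll p (contents w (x :: v) S c (m + 1) ns r a b []) L T)
    (hT : T ≤ 15 * k * k + 100 * k + 150) (hm : m + 1 ≤ k) (ha : a ≤ k) (hb : b ≤ k)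
    (hr : r.length ≤ k) :
    ScansTo t (contents (x :: w) v S c m (a :: b :: ns) r 0 0 X.write)
      (contents w (x :: v) S c (m + 1) ((m + 1) :: ns) [] 0 0 (conjoin L X).write)
      (letterTime k) := by
  refine (ScansTo.letter (hx ▸ Runs.block_cons (runs_popNumber_fst ha) (.block_cons
    (runs_popNumber_snd hb) (.block_cons h.runs
    (.block_cons (runs_finishConcept hm ha hb hr) .block_nil))))).mono ?_
  simp only [letterTime]
  omega

/-- Prefix notation read backwards is postfix notation: when the first letter of `D` is reached, the
positions of its immediate subconcepts are on top of `results`, and the scan replaces them by the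
position of `D`. Stating this with `ScansTo` lets the single loop over the whole word be cut at the
borders of subconcepts. -/
theorem scansTo_write (hS : S.length = k) (D : Concept n) :
    ∀ (w v : List (Letter n)) (m : ℕ) (ns : List ℕ) (X : LinConcept n), m + D.write.length ≤ k →
      ScansTo t (contents (D.write.reverse ++ w) v S c m ns [] 0 0 X.write)
        (contents w (D.write ++ v) S c (m + D.write.length) ((m + D.write.length) :: ns) [] 0 0
          (conjoin (constraints t S D m) X).write)
        (D.write.length * letterTime k) := by
  have hcur {w v m ns r a b} (hm : m ≤ k) :
      Writes (writePos .cur) (contents w v S c m ns r a b []) (posAtom m) (5 * k + 8) :=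
    writes_writePos rfl (by decide) (by decide) rfl hm
  have hfst {w v m ns r a b} (ha : a ≤ k) :
      Writes (writePos .fst) (contents w v S c m ns r a b []) (posAtom a) (5 * k + 8) :=
    writes_writePos rfl (by decide) (by decide) rfl ha
  have hsnd {w v m ns r a b} (hb : b ≤ k) :
      Writes (writePos .snd) (contents w v S c m ns r a b []) (posAtom b) (5 * k + 8) :=
    writes_writePos rfl (by decide) (by decide) rfl hb
  have hname {w v m ns r a b} (b₁ b₂ : Bool) (hr : r.length ≤ k) :
      Writes (writeNamed b₁ b₂) (contents w v S c m ns r a b []) (.atom (b₁ :: b₂ :: r))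
        (5 * k + 8) :=
    writes_writeNamed b₁ b₂ rfl rfl hr
  have hlen (A : Name) : (writeName (n := n) A).length = A.length + 1 := by simp [writeName]
  have htime (l : ℕ) : l * letterTime k + letterTime k ≤ (l + 1) * letterTime k := by
    rw [Nat.succ_mul]
  have htime' (l : ℕ) : 5 * l + letterTime k ≤ (l + 1) * letterTime k := by
    rw [Nat.succ_mul l, Nat.mul_comm 5]
    gcongr
    simp only [letterTime]
    omega
  induction D with
  | atom A =>
    intro w v m ns X hm
    simp only [Concept.write, List.length_cons, hlen] at hm
    have h := (scansTo_writeName (t := t) (w := .concept :: w) (v := v) (S := S) (c := c) (m := m)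
      (ns := ns) (o := X.write) A).trans (.leaf (k := k) rfl
        (.equivalence (hcur (by rw [hlen]; omega)) (hname true false (by omega))) (by omega)
        (by rw [hlen]; omega) (by omega))
    simp only [Concept.write, List.reverse_cons, List.append_assoc, List.singleton_append]
    exact h.mono (htime' _)
  | nominal a =>
    intro w v m ns X hm
    simp only [Concept.write, List.length_cons, hlen] at hm
    have hN {s} (hs : Writes (writeNamed true true) s (.atom (nominalName a)) (5 * k + 8)) :
        WritesAll (writeNameConstraint t) s (nameConstraint (n := n) t a) (5 * k + 12) := by
      cases t with
      | total => exact WritesAll.of_writes (Writes.existsOrd hs)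
      | partially => exact fun _ _ => (Runs.nop _).mono (by omega)
    have h := (scansTo_writeName (t := t) (w := .nominal :: w) (v := v) (S := S) (c := c) (m := m)
      (ns := ns) (o := X.write) a).trans (.leaf (k := k) rfl
        (.cons (.equivalence (hcur (by rw [hlen]; omega))
          (writes_writeLastNominal (k := k) rfl rfl (by omega)))
          (.cons (hN (hname true true (by omega))) .nil))
        (by omega) (by rw [hlen]; omega) (by omega))
    simp only [Concept.write, List.reverse_cons, List.append_assoc, List.singleton_append]
    rw [List.append_nil] at h
    exact h.mono (htime' _)
  | neg D ih =>
    intro w v m ns X hm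
    simp only [Concept.write, List.length_cons] at hm
    have h := (ih (.neg :: w) v m ns X (by omega)).trans (.unary (k := k) rfl
      (.equivalence (hcur (by omega)) (Writes.neg (hfst (by omega)))) (by omega) (by omega)
      (by omega) (Nat.zero_le _))
    simp only [Concept.write, List.reverse_cons, List.append_assoc, List.singleton_append]
    rw [← conjoin_append] at h
    exact h.mono (htime _)
  | and D E ihD ihE =>
    intro w v m ns X hm
    simp only [Concept.write, List.length_cons, List.length_append] at hm
    -- The right conjunct is scanned first, so the position of the left one ends on top and is
    -- popped into `fst`.
    have h := ((ihE (D.write.reverse ++ .and :: w) v m ns X (by omega)).trans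
      (ihD (.and :: w) (E.write ++ v) _ _ _ (by omega))).trans (.binary (k := k) rfl
        (.equivalence (hcur (by omega)) (Writes.and (hfst (by omega)) (hsnd (by omega))))
        (by omega) (by omega) (by omega) (by omega) (Nat.zero_le _))
    rw [← conjoin_append, ← conjoin_append, List.append_assoc, ← Nat.add_mul,
      show m + E.write.length + D.write.length + 1 = m + (D.and E).write.length by
        simp [Concept.write]; omega] at h
    simp only [Concept.write, List.reverse_cons, List.reverse_append, List.append_assoc,
      List.cons_append] at h ⊢
    refine h.mono ((htime _).trans_eq ?_)
    simp only [List.length_cons, List.length_append, Nat.add_comm]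
  | existsRole r D ih =>
    intro w v m ns X hm
    simp only [Concept.write, List.length_cons, List.length_append, hlen] at hm
    have h := ((ih ((writeName r).reverse ++ .existsRole :: w) v m ns X (by omega)).trans
      (scansTo_writeName r)).trans (.unary (k := k) rfl
        (.cons (.equivalence (hcur (by rw [hlen]; omega))
          (writes_writeRole (k := k) rfl (by decide) (by decide) rfl rfl (by omega) (by omega)))
          (.cons (.of_writes (writes_writeWitnessConstraint (k := k) rfl rfl rfl hS rfl (by decide)
            (by decide) rfl rfl (by omega) (by omega))) .nil))
        ?_ (by rw [hlen]; omega) (by omega) (by omega))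
    · rw [← conjoin_append, show m + D.write.length + (writeName (n := n) r).length + 1 =
        m + (D.existsRole r).write.length by simp [Concept.write]; omega] at h
      simp only [Concept.write, List.reverse_cons, List.reverse_append, List.append_assoc,
        List.cons_append] at h ⊢
      refine h.mono ?_
      have h₁ := htime' (writeName (n := n) r).length
      have h₂ : ((writeName (n := n) r).length + D.write.length + 1) * letterTime k =
          ((writeName (n := n) r).length + 1) * letterTime k + D.write.length * letterTime k := by
        ring
      rw [List.length_cons, List.length_append, h₂]
      omega
    · ring_nf
      nlinarith
  | existsUniv D ih =>
    intro w v m ns X hm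
    simp only [Concept.write, List.length_cons] at hm
    have h := (ih (.existsUniv :: w) v m ns X (by omega)).trans (.unary (k := k) rfl
      (.cons (.of_writes (Writes.neg (Writes.and (Writes.existsOrd (hcur (by omega)))
        (Writes.neg (Writes.existsOrd (hfst (by omega)))))))
        (.cons (.of_writes (Writes.neg (Writes.and (Writes.existsOrd (Writes.neg
          (hcur (by omega)))) (Writes.existsOrd (hfst (by omega)))))) .nil)) (by omega) (by omega)
      (by omega) (Nat.zero_le _))
    simp only [Concept.write, List.reverse_cons, List.append_assoc, List.singleton_append]
    rw [← conjoin_append] at h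
    exact h.mono (htime _)
  | dia i D ih =>
    intro w v m ns X hm
    simp only [Concept.write, List.length_cons] at hm
    have h := (ih (.dia i :: w) v m ns X (by omega)).trans (.unary (k := k) rfl
      (.equivalence (hcur (by omega)) (Writes.dia (hfst (by omega)))) (by omega) (by omega)
      (by omega) (Nat.zero_le _))
    simp only [Concept.write, List.reverse_cons, List.append_assoc, List.singleton_append]
    rw [← conjoin_append] at h
    exact h.mono (htime _)

end

end ModalDL

namespace ModalDL

open StackProgram StackProgram.Prog LinConcept Function

variable {n : ℕ}

/-! ### The translating machine -/

/-- Replace the digits of a number by those of the next one, and set the flag unless there is an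
overflow. -/
def nextSelection : Program n :=
  seq (loop .sel isOne fun _ => push .tmp (.bit false))
    (popCase .sel fun o => match o with
      -- Overflow: all digits were ones, the flag stays unset, and the loop in `writeConstraints`
      -- ends.
      | none => clear .tmp
      | some _ => block [push .sel (.bit true), moveAll .tmp .sel, push .flag .endMark])

/-- Write the constraints for all selections. -/
def writeConstraints (t : NameKind) : Program n :=
  forEach .flag fun _ =>
    block [scan t, moveAll .seen .word, clear .cur, clear .results, nextSelection]

/-- Set up the stacks for `writeConstraints`. -/
def setUp : Program n :=
  -- Both `word` and `count` receive the input, to be scanned and to count the boxes; the zeros on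
  -- `sel` are the first selection.
  block [forEach .input fun a => block [push .word a, push .count a, push .sel (.bit false)],
    pushAll .out valid.write, push .flag .endMark]

/-- The two occurrences of the concept in `boxStep` require two copies; they are stored reversed on
`tmp` and `sel'`, and moving them to the output restores the order. -/
def writeBoxStep (i : Fin n) : Program n :=
  block [forEach .out fun a => seq (push .tmp a) (push .sel' a), moveAll .tmp .out,
    pushAll .out [.neg, .dia i, .neg], moveAll .sel' .out, push .out .and]

/-- Apply `boxRound` once for every letter on the stack `count`. -/
def writeBoxes : Program n := forEach .count fun _ => block ((List.finRange n).map writeBoxStep)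

/-- Add the first conjunct of the translation. -/
def writeRoot : Program n :=
  block [push .out .endMark, forEach .word fun _ => push .out (.bit true),
    pushAll .out [.and, .existsOrd, .concept, .bit false, .bit false]]

/-- The program that computes the translation. -/
def translateProgram (t : NameKind) : Program n :=
  block [setUp, writeConstraints t, writeBoxes, writeRoot]

theorem digits_zero (k : ℕ) : digits k 0 = List.replicate k false := by
  induction k with
  | zero => rfl
  | succ k ih => simp [digits, ih, List.replicate_succ]

theorem length_digits (k j : ℕ) : (digits k j).length = k := by
  induction k generalizing j with
  | zero => rfl
  | succ k ih => simp [digits, ih]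

theorem digits_last {k j : ℕ} (h : j + 1 = 2 ^ k) : digits k j = List.replicate k true := by
  induction k generalizing j with
  | zero => rfl
  | succ k ih =>
    have hj := Nat.bodd_add_div2 j
    rw [pow_succ] at h
    cases hb : j.bodd
    · simp [hb] at hj
      omega
    · simp [hb] at hj
      simp [digits, hb, ih (j := j.div2) (by omega), List.replicate_succ]

/-- Adding one turns the leading ones (the lowest digits) into zeros and the first zero into a one,
which is what `nextSelection` does on the stack. -/
theorem digits_succ {k j : ℕ} (h : j + 1 < 2 ^ k) : ∃ a R,
    digits k j = List.replicate a true ++ false :: R ∧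
      digits k (j + 1) = List.replicate a false ++ true :: R := by
  induction k generalizing j with
  | zero => simp at h
  | succ k ih =>
    have hj := Nat.bodd_add_div2 j
    rw [pow_succ] at h
    cases hb : j.bodd
    · exact ⟨0, digits k j.div2, by simp [digits, hb], by
        simp [digits, hb, Nat.div2_succ]⟩
    · simp [hb] at hj
      obtain ⟨a, R, h₁, h₂⟩ := ih (j := j.div2) (by omega)
      exact ⟨a + 1, R, by simp [digits, hb, h₁, List.replicate_succ], by
        simp [digits, hb, Nat.div2_succ, h₂, List.replicate_succ]⟩

section

variable {s : Reg → List (Letter n)} {k : ℕ} {t : NameKind}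

theorem runs_nextSelection_loop (a : ℕ) {L : List (Letter n)} (hL : L.head?.any isOne = false) :
    ∀ s : Reg → List (Letter n), s .sel = ones a ++ L →
      Runs (loop .sel isOne fun _ => push .tmp (.bit false)) s
        (update (update s .tmp (List.replicate a (.bit false) ++ s .tmp)) .sel L) (2 * a + 1) := by
  induction a with
  | zero =>
    intro s hs
    have hs : s .sel = L := hs
    refine (Runs.loop_exit (hs ▸ hL)).of_eq ?_
    simp [← hs]
  | succ a ih =>
    intro s hs
    refine Runs.convert (Runs.loop_step (f := fun _ => push Reg.tmp (.bit false)) (a := .bit true)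
      (l := ones a ++ L) ?_ rfl (.push _ _ _) (ih _ ?_)) ?_ ?_
    · simpa [ones, List.replicate_succ] using hs
    · simp
    · omega
    · funext r
      cases r <;> simp [List.replicate_succ' (n := a)]

theorem runs_nextSelection {j : ℕ} (hj : j + 1 < 2 ^ k) (hs : s .sel = (digits k j).map .bit)
    (ht : s .tmp = []) (hf : s .flag = []) :
    Runs nextSelection s (update (update s .sel ((digits k (j + 1)).map .bit)) .flag [.endMark])
      (4 * k + 6) := by
  obtain ⟨a, R, h₁, h₂⟩ := digits_succ hj
  have ha : a ≤ k := by
    have := congrArg List.length h₁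
    simp [length_digits] at this
    omega
  rw [h₁] at hs
  refine Runs.mono (Runs.seq (runs_nextSelection_loop a (L := .bit false :: R.map .bit) rfl s
    (by simpa [ones] using hs)) (.popCase (t := 2 * a + 4) ?_)) (by omega)
  simp only [update_self, List.head?_cons]
  refine Runs.convert (Runs.block_cons (.push _ _ _) (.block_cons
    (.moveAll (w := List.replicate a (.bit false)) (by decide) (by simp [ht]))
    (.block_cons (.push _ _ _) .block_nil))) ?_ ?_
  · simp
    omega
  · rw [h₂]
    funext r
    cases r <;> simp [ht, hf]

theorem runs_nextSelection_last {j : ℕ} (hj : j + 1 = 2 ^ k) (hs : s .sel = (digits k j).map .bit)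
    (ht : s .tmp = []) : Runs nextSelection s (update s .sel []) (4 * k + 6) := by
  rw [digits_last hj, map_replicate_true] at hs
  refine Runs.mono (Runs.seq (runs_nextSelection_loop k (L := []) rfl s (by simpa using hs))
    (.popCase (t := 2 * k + 1) ?_)) (by omega)
  simp only [update_self, List.head?_nil]
  refine Runs.convert (Runs.clear (w := List.replicate k (.bit false)) (by simp [ht])) (by simp) ?_
  funext r
  cases r <;> simp [ht]

/-- A bound for the time that is needed to write the constraints for a selection. -/
def roundTime (k : ℕ) : ℕ := k * letterTime k + 20 * k + 30

variable {C : Concept n} {c : List (Letter n)}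

theorem runs_round {S : List Bool} {X : LinConcept n} {s' : Reg → List (Letter n)}
    (hS : S.length = C.write.length)
    (h : Runs nextSelection (contents C.write.reverse [] S c 0 [] [] 0 0
      (conjoin (constraints t S C 0) X).write) s' (4 * C.write.length + 6)) :
    Runs (block [scan t, moveAll .seen .word, clear .cur, clear .results, nextSelection])
      (contents C.write.reverse [] S c 0 [] [] 0 0 X.write) s' (roundTime C.write.length) := by
  have h₁ := scansTo_write (t := t) (c := c) hS C [] [] 0 [] X (by simp) _ _ (Runs.forEach_nil rfl)
  simp only [List.append_nil, Nat.zero_add] at h₁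
  refine Runs.mono (Runs.block_cons h₁ (.block_cons (.moveAll (by decide) rfl)
    (.block_cons (.clear rfl) (.block_cons (.clear rfl) (.block_cons (?_ : Runs _ _ s'
      (4 * C.write.length + 6)) .block_nil))))) ?_
  · refine cast ?_ h
    congr 1
    funext r
    cases r <;> simp [contents, ones, numbers]
  · simp [contents, ones, numbers, roundTime]
    omega

/-- The induction is on the number of selections still to come after the current one, `j`. The last
round is separate because there the counter overflows and `sel` ends empty. -/
theorem runs_writeConstraints (i j : ℕ) (h : j + (i + 1) = 2 ^ C.write.length) :
    Runs (writeConstraints t)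
      (update (contents C.write.reverse [] (digits C.write.length j) c 0 [] [] 0 0
        (allConstraints t C j).write) .flag [.endMark])
      (contents C.write.reverse [] [] c 0 [] [] 0 0
        (allConstraints t C (2 ^ C.write.length)).write)
      ((i + 1) * (roundTime C.write.length + 1) + 1) := by
  have hs (j : ℕ) (x : List (Letter n)) : update (update (contents C.write.reverse []
      (digits C.write.length j) c 0 [] [] 0 0 (allConstraints t C j).write) .flag x) .flag [] =
      contents C.write.reverse [] (digits C.write.length j) c 0 [] [] 0 0
        (allConstraints t C j).write := by
    funext r
    cases r <;> rfl
  induction i generalizing j with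
  | zero =>
    refine Runs.mono (Runs.forEach_cons rfl ((hs j _).symm ▸ runs_round (length_digits _ _)
      (runs_nextSelection_last h rfl rfl)) ((Runs.forEach_nil rfl).of_eq ?_)) ?_
    · rw [← h]
      funext r
      cases r <;> rfl
    · omega
  | succ i ih =>
    refine Runs.mono (Runs.forEach_cons rfl ((hs j _).symm ▸ runs_round (length_digits _ _)
      ((runs_nextSelection (j := j) (by omega) rfl rfl rfl).of_eq ?_)) (ih (j + 1) (by omega))) ?_
    · rw [Nat.succ_mul (i + 1)]
      omega
    · funext r
      cases r <;> rfl

theorem runs_setUp (W : List (Letter n)) :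
    Runs setUp (update (fun _ => []) .input W)
      (update (contents W.reverse [] (digits W.length 0) W.reverse 0 [] [] 0 0 valid.write) .flag
        [.endMark]) (5 * W.length + 11) := by
  have h (W : List (Letter n)) : ∀ (w c : List (Letter n)) (j : ℕ),
      Runs (forEach .input fun a => block [push .word a, push .count a, push .sel (.bit false)])
        (update (contents w [] (List.replicate j false) c 0 [] [] 0 0 []) .input W)
        (contents (W.reverse ++ w) [] (List.replicate (j + W.length) false) (W.reverse ++ c) 0 [] []
          0 0 []) (5 * W.length + 1) := by
    induction W with
    | nil =>
      intro w c j
      refine (Runs.forEach_nil rfl).of_eq ?_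
      funext r
      cases r <;> rfl
    | cons a W ih =>
      intro w c j
      refine Runs.convert (Runs.forEach_cons rfl (.block_cons (.push _ _ _) (.block_cons (.push _ _ _)
        (.block_cons (.push' ?_) .block_nil))) (ih (a :: w) (a :: c) (j + 1))) ?_ ?_
      · funext r
        cases r <;> simp [contents, List.replicate_succ]
      · simp
        omega
      · rw [Nat.add_right_comm]
        simp [Nat.add_assoc]
  have h₀ := h W [] [] 0
  have hs : update (contents [] [] (List.replicate 0 false) [] 0 [] [] 0 0 []) .input W =
      update (fun _ => []) .input W := by
    funext r
    cases r <;> rfl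
  rw [hs] at h₀
  refine Runs.convert (Runs.block_cons h₀ (.block_cons (Emits.pushAll (o := Reg.out)).runs
    (.block_cons (.push _ _ _) .block_nil))) ?_ ?_
  · simp [valid, LinConcept.write, writeName]
  · funext r
    cases r <;> simp [contents, digits_zero]

theorem runs_writeBoxStep (i : Fin n) {X : LinConcept n} (ht : s .tmp = []) (hs : s .sel' = []) :
    Runs (writeBoxStep i) (update s .out X.write) (update s .out (boxStep X i).write)
      (7 * X.write.length + 9) := by
  have h (W : List (Letter n)) : ∀ s : Reg → List (Letter n), s .out = W →
      Runs (forEach .out fun a => seq (push .tmp a) (push .sel' a)) s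
        (update (update (update s .out []) .tmp (W.reverse ++ s .tmp)) .sel'
          (W.reverse ++ s .sel')) (3 * W.length + 1) := by
    induction W with
    | nil =>
      intro s hs
      refine (Runs.forEach_nil hs).of_eq ?_
      funext r
      cases r <;> simp [hs]
    | cons a W ih =>
      intro s hs
      refine Runs.convert (Runs.forEach_cons hs (.seq (.push _ _ _) (.push _ _ _)) (ih _ ?_)) ?_ ?_
      · simp
      · simp
        omega
      · funext r
        cases r <;> simp
  refine Runs.convert (Runs.block_cons (h X.write _ (by simp)) (.block_cons
    (.moveAll (w := X.write.reverse) (by decide) (by simp [ht]))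
    (.block_cons (Emits.pushAll (o := Reg.out)).runs (.block_cons
      (.moveAll (w := X.write.reverse) (by decide) (by simp [hs]))
      (.block_cons (.push _ _ _) .block_nil))))) ?_ ?_
  · simp
    omega
  · funext r
    cases r <;> simp [ht, hs, boxStep, LinConcept.write]

/-- A box step duplicates the concept and adds four letters; shifting the length by 4 makes this an
exact doubling. -/
theorem length_write_boxStep (X : LinConcept n) (i : Fin n) :
    (boxStep X i).write.length + 4 = (X.write.length + 4) * 2 := by
  simp [boxStep, LinConcept.write]
  omega

theorem length_write_foldl_boxStep (l : List (Fin n)) (X : LinConcept n) :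
    (l.foldl boxStep X).write.length + 4 = (X.write.length + 4) * 2 ^ l.length := by
  induction l generalizing X with
  | nil => simp
  | cons i l ih =>
    rw [List.foldl_cons, ih, length_write_boxStep, List.length_cons, pow_succ']
    ring

theorem runs_writeBoxStep_list (l : List (Fin n)) {X : LinConcept n} (ht : s .tmp = [])
    (hs : s .sel' = []) :
    Runs (block (l.map writeBoxStep)) (update s .out X.write)
      (update s .out (l.foldl boxStep X).write)
      ((l.length + 1) * (10 * ((X.write.length + 4) * 2 ^ l.length))) := by
  induction l generalizing X with
  | nil => exact Runs.block_nil.mono (by simp; omega)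
  | cons i l ih =>
    refine (Runs.block_cons (runs_writeBoxStep i ht hs) ih).mono ?_
    rw [length_write_boxStep, List.length_cons, pow_succ', ← Nat.mul_assoc (X.write.length + 4) 2,
      Nat.succ_mul (l.length + 1), Nat.add_comm]
    have : (X.write.length + 4) * 2 ≤ (X.write.length + 4) * 2 * 2 ^ l.length :=
      Nat.le_mul_of_pos_right _ (by positivity)
    omega

/-- Lengths only grow, so every round is charged at the size reached at the end, which gives the
factor `2 ^ (n * w.length)`. -/
theorem runs_writeBoxes (w : List (Letter n)) {X : LinConcept n} (hs : s .count = w)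
    (ht : s .tmp = []) (hs' : s .sel' = []) :
    Runs writeBoxes (update s .out X.write)
      (update (update s .count []) .out (boxRound^[w.length] X).write)
      (w.length * ((n + 1) * (10 * ((X.write.length + 4) * 2 ^ (n * w.length))) + 1) + 1) := by
  induction w generalizing s X with
  | nil =>
    refine Runs.convert (Runs.forEach_nil (by simpa using hs)) (by simp) ?_
    funext r
    cases r <;> simp [hs]
  | cons a w ih =>
    have h := runs_writeBoxStep_list (s := update s .count w) (List.finRange n) (X := X)
      (by simpa using ht) (by simpa using hs')
    have h' := ih (s := update s .count w) (X := boxRound X) (by simp) (by simpa using ht)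
      (by simpa using hs')
    have he : update (update s .count w) .out X.write =
        update (update s .out X.write) .count w := update_comm (by decide) _ _ _
    rw [he] at h
    refine Runs.convert (Runs.forEach_cons (by simpa using hs) h h') ?_ ?_
    · rw [boxRound, length_write_foldl_boxStep, List.length_finRange, Nat.mul_assoc _ (2 ^ n),
        ← pow_add, List.length_cons, show n + n * w.length = n * (w.length + 1) by ring,
        Nat.succ_mul w.length]
      have : 2 ^ n ≤ 2 ^ (n * (w.length + 1)) :=
        Nat.pow_le_pow_right (by norm_num) (Nat.le_mul_of_pos_right _ (by omega))
      have : (n + 1) * (10 * ((X.write.length + 4) * 2 ^ n)) ≤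
          (n + 1) * (10 * ((X.write.length + 4) * 2 ^ (n * (w.length + 1)))) := by
        gcongr
      omega
    · rw [List.length_cons, Function.iterate_succ_apply]
      simp

theorem runs_writeRoot {w o : List (Letter n)} {m : ℕ} (hw : w.length = m) :
    Runs writeRoot (contents w [] [] [] 0 [] [] 0 0 o)
      (update (fun _ => []) .out
        (.and :: .existsOrd :: ((posAtom m : LinConcept n).write ++ o))) (2 * m + 9) := by
  have h (w : List (Letter n)) : ∀ o, Runs (forEach .word fun _ => push .out (.bit true))
      (contents w [] [] [] 0 [] [] 0 0 o)
      (contents [] [] [] [] 0 [] [] 0 0 (ones w.length ++ o)) (2 * w.length + 1) := by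
    induction w with
    | nil => exact fun _ => Runs.forEach_nil rfl
    | cons a w ih =>
      intro o
      refine Runs.convert (Runs.forEach_cons rfl (.push' ?_) (ih (.bit true :: o))) ?_ ?_
      · funext r
        cases r <;> rfl
      · simp
        omega
      · rw [List.length_cons, ones, ones, List.replicate_succ']
        simp
  refine Runs.convert (Runs.block_cons (.push' ?_) (.block_cons (h w (.endMark :: o))
    (.block_cons (Emits.pushAll (o := Reg.out)).runs .block_nil))) ?_ ?_
  · funext r
    cases r <;> rfl
  · simp
    omega
  · rw [hw]
    funext r
    cases r <;> simp [contents, ones, numbers, posAtom, posName, LinConcept.write, writeName]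

/-- A bound for the running time of the translating machine up to the last two phases. -/
def constraintsTime (k : ℕ) : ℕ := 5 * k + 12 + 2 ^ k * (roundTime k + 1)

/-- A bound for the running time of the translating machine. -/
def translateTime (n k : ℕ) : ℕ :=
  constraintsTime k + k * ((n + 1) * (10 * ((constraintsTime k + 4) * 2 ^ (n * k))) + 1) +
    2 * k + 11

theorem runs_translateProgram (t : NameKind) (C : Concept n) :
    Runs (translateProgram t) (update (fun _ => []) .input C.write)
      (update (fun _ => []) .out (translate t C).write) (translateTime n C.write.length) := by
  obtain ⟨i, hi⟩ : ∃ i, 0 + (i + 1) = 2 ^ C.write.length :=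
    ⟨2 ^ C.write.length - 1, by have := Nat.two_pow_pos C.write.length; omega⟩
  have h₁ := runs_setUp C.write
  have h₂ := runs_writeConstraints (t := t) (c := C.write.reverse) i 0 hi
  rw [show i + 1 = 2 ^ C.write.length by omega] at h₂
  -- The time spent so far bounds the length of the concept that the boxes are applied to.
  have h₁₂ := (Runs.seq h₁ h₂).length_le .out
  have h₃ := runs_writeBoxes (s := contents C.write.reverse [] [] C.write.reverse 0 [] [] 0 0 [])
    C.write.reverse (X := allConstraints t C (2 ^ C.write.length)) rfl rfl rfl
  rw [update_contents_out, List.length_reverse] at h₃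
  have hs : update (update (contents C.write.reverse [] [] C.write.reverse 0 [] [] 0 0 []) .count
      []) .out (boxRound^[C.write.length] (allConstraints t C (2 ^ C.write.length))).write =
      contents C.write.reverse [] [] [] 0 [] [] 0 0
        (boxRound^[C.write.length] (allConstraints t C (2 ^ C.write.length))).write := by
    funext r
    cases r <;> rfl
  rw [hs] at h₃
  have h₄ := runs_writeRoot (w := C.write.reverse) (m := C.write.length)
    (o := (boxRound^[C.write.length] (allConstraints t C (2 ^ C.write.length))).write) (by simp)
  refine Runs.mono (Runs.block_cons h₁ (.block_cons h₂ (.block_cons h₃ (.block_cons h₄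
    .block_nil)))) ?_
  have hX : (allConstraints t C (2 ^ C.write.length)).write.length ≤
      constraintsTime C.write.length := by
    refine h₁₂.trans ?_
    simp [constraintsTime]
    omega
  have : (n + 1) * (10 * (((allConstraints t C (2 ^ C.write.length)).write.length + 4) *
      2 ^ (n * C.write.length))) ≤
      (n + 1) * (10 * ((constraintsTime C.write.length + 4) * 2 ^ (n * C.write.length))) := by
    gcongr
  have := Nat.mul_le_mul_left C.write.length (Nat.add_le_add_right this 1)
  simp only [translateTime]
  have : constraintsTime C.write.length = 5 * C.write.length + 12 +
    2 ^ C.write.length * (roundTime C.write.length + 1) := rfl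
  omega

/-! ### The time bound and the reduction -/

/-- With `K = 2 ^ k`, a round takes time of order at most `K ^ 3`, all rounds together `K ^ 4`, and
the repetition of the box phase gives `K ^ 5`, multiplied by `2 ^ n` and `2 ^ (n * k)`. The factor
`2 ^ 14` absorbs the constants. The time is thus singly exponential, and `x < 2 ^ x` gives the
double exponential. -/
theorem translateTime_le (n k : ℕ) :
    translateTime n k + 1 ≤ 2 ^ 2 ^ (n + 14 + (n + 5) * k) := by
  have h : translateTime n k + 1 ≤ 2 ^ (n + 14 + (n + 5) * k) := by
    have he : 2 ^ (n + 14 + (n + 5) * k) = 16384 * (2 ^ n * ((2 ^ k) ^ 5 * 2 ^ (n * k))) := by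
      rw [← pow_mul, ← pow_add, ← pow_add, show (16384 : ℕ) = 2 ^ 14 by norm_num, ← pow_add]
      congr 1
      ring
    have hk : k ≤ 2 ^ k := Nat.lt_two_pow_self.le
    have hn : n + 1 ≤ 2 ^ n := Nat.lt_two_pow_self
    have hK : 1 ≤ 2 ^ k := Nat.one_le_two_pow
    have hN : 1 ≤ 2 ^ (n * k) := Nat.one_le_two_pow
    have hH : 1 ≤ 2 ^ n := Nat.one_le_two_pow
    rw [he]
    simp only [translateTime, constraintsTime, roundTime, letterTime]
    generalize 2 ^ k = K at *
    generalize 2 ^ (n * k) = N at *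
    generalize 2 ^ n = H at *
    have hpow (i : ℕ) : K ^ i ≤ K ^ (i + 1) := Nat.pow_le_pow_right hK (Nat.le_succ i)
    have p₁ : K ≤ K ^ 2 := by simpa using hpow 1
    have p₂ : K ^ 2 ≤ K ^ 3 := hpow 2
    have p₃ : K ^ 3 ≤ K ^ 4 := hpow 3
    have p₄ : K ^ 4 ≤ K ^ 5 := hpow 4
    have h₁ : k * (15 * k * k + 120 * k + 200) + 20 * k + 30 + 1 ≤ 386 * K ^ 3 := calc
      _ ≤ K * (15 * K * K + 120 * K + 200) + 20 * K + 30 + 1 := by gcongr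
      _ = 15 * K ^ 3 + 120 * K ^ 2 + 220 * K + 31 := by ring
      _ ≤ 386 * K ^ 3 := by omega
    have h₂ : 5 * k + 12 + K * (k * (15 * k * k + 120 * k + 200) + 20 * k + 30 + 1) ≤
        403 * K ^ 4 := calc
      _ ≤ 5 * K + 12 + K * (386 * K ^ 3) := by gcongr
      _ = 386 * K ^ 4 + 5 * K + 12 := by ring
      _ ≤ 403 * K ^ 4 := by omega
    have h₃ : K ^ 5 ≤ H * (K ^ 5 * N) :=
      (Nat.le_mul_of_pos_right _ hN).trans (Nat.le_mul_of_pos_left _ hH)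
    generalize 5 * k + 12 + K * (k * (15 * k * k + 120 * k + 200) + 20 * k + 30 + 1) = c at *
    calc
      _ ≤ 403 * K ^ 4 + K * (H * (10 * ((403 * K ^ 4 + 4 * K ^ 4) * N)) + 1) + 2 * K + 11 + 1 := by
        have : 4 ≤ 4 * K ^ 4 := by omega
        gcongr
      _ = 4070 * (H * (K ^ 5 * N)) + 403 * K ^ 4 + 3 * K + 12 := by ring
      _ ≤ _ := by omega
  exact h.trans (Nat.pow_le_pow_right (by norm_num) Nat.lt_two_pow_self.le)

noncomputable instance : Fintype (Letter n) :=
  have : Function.Injective fun x : Letter n => match x with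
      | .concept => (Sum.inl 0 : Fin 10 ⊕ Fin n)
      | .nominal => .inl 1
      | .neg => .inl 2
      | .and => .inl 3
      | .existsRole => .inl 4
      | .existsUniv => .inl 5
      | .existsOrd => .inl 6
      | .bit true => .inl 7
      | .bit false => .inl 8
      | .endMark => .inl 9
      | .dia i => .inr i := by
    intro x y h
    rcases x with _ | _ | _ | _ | _ | _ | _ | i | (_ | _) | _ <;>
      rcases y with _ | _ | _ | _ | _ | _ | _ | i | (_ | _) | _ <;> simp_all
  Fintype.ofInjective _ this

theorem computable_translate (t : NameKind) : ComputableInDoubleExpTime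
    (Concept.write (n := n)) (LinConcept.write (n := n)) (translate t) := by
  obtain ⟨T, hT, ht⟩ := exists_tm2ComputableInTime (ea := Concept.write (n := n))
    (eb := LinConcept.write (n := n)) (f := translate t) (translateProgram t) .input .out
    (translateTime n) (runs_translateProgram t)
  refine ⟨T, hT, Polynomial.C (n + 14) + Polynomial.C (n + 5) * Polynomial.X, fun k => ?_⟩
  rw [ht]
  refine (translateTime_le n k).trans_eq ?_
  simp

end

end ModalDL

theorem mainTheorem3 (n : ℕ) (𝒞 : Set (ModalDL.Frame.{u} n))
    (k : ModalDL.DomainKind) (t : ModalDL.NameKind) :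
    ModalDL.ReducibleInDoubleExpTime
      (ModalDL.Concept.write (n := n)) (ModalDL.LinConcept.write (n := n))
      (ModalDL.Concept.Satisfiable.{u, v} 𝒞 k t)
      (ModalDL.LinConcept.Satisfiable.{u, v} 𝒞 k) :=
  ⟨ModalDL.translate t, ModalDL.computable_translate t,
    ModalDL.satisfiable_iff_translate 𝒞 k t⟩
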